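/- **Setting.** Let $n\ge 2$. A continuous (resp. smooth) spacetime is a smooth manifold of dimension $n+1$ with a continuous (resp. smooth) Lorentzian metric of signature $(-,+,\dots,+)$ and a time orientation. In a continuous spacetime, a *future directed timelike curve* is a Lipschitz curve $\gamma\colon[a,b]\to M$, $a<b$, whose velocity is future directed timelike almost everywhere and satisfies $g(\gamma',\gamma')<-\varepsilon$ almost everywhere for some $\varepsilon>0$; a *future directed causal curve* is a Lipschitz curve whose velocity is future directed causal almost everywhere. $I^+(p,U)$ is the set of endpoints of future directed timelike curves in $U$ starting at $p$, and $J^+(p,U)$ is $\{p\}$ together with the endpoints of future directed causal curves in $U$ starting at $p$. A continuous spacetime $(M_{\rm ext},g_{\rm ext})$ is a *continuous extension* of a smooth spacetime $(M,g)$ of the same dimension if $(M,g)$ embeds isometrically, preserving time orientations, onto a proper (open) subset of it, with which $M$ is identified. Let $\partial M=\overline M\setminus M$, and let $\partial^-M$ be the set of $p\in\partial M$ for which there is a future directed timelike curve $\gamma\colon[a,b]\to M_{\rm ext}$ with $\gamma(a)=p$ and $\gamma((a,b])\subset M$. A function on $M$ *extends continuously* to $M\cup\{\mathcal O\}$ if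 it is the restriction of a continuous function on $M\cup\{\mathcal O\}$ (with the subspace topology from $M_{\rm ext}$); a tensor on $M$ extends continuously if its components in some coordinate neighborhood of $\mathcal O$ do. Extensions are denoted by a tilde. **Corollary.** Let $(M_{\rm ext},g_{\rm ext})$ be a continuous extension of a smooth spacetime $(M,g)$ such that $M=I^+(\mathcal O,M_{\rm ext})$ for some $\mathcal O\in\partial^-M$. Assume: (a) $(M,g)$ solves the Einstein equations with a perfect fluid $(u,\rho,p)$: $u$ is a smooth future directed timelike vector field on $M$ with $g(u,u)=-1$, $\rho$ and $p$ are smooth functions on $M$, and $\mathrm{Ric}-\tfrac12Rg=8\pi\big[(\rho+p)\,u_*\otimes u_*+p\,g\big]$ on $M$, where $u_*=g(u,\cdot)$. (b) All integral curves of $u$ have past endpoint $\mathcal O$ in $M_{\rm ext}$, and the curves extended by this endpoint are future directed timelike curves on every compact domain; that is, every integral curve of $u$ on an interval $(c,d)$ continues to the past to an integral curve $\gamma$ in $M$ on an interval $(a,d)$, $-\infty<a\le c$, with $\gamma(\tau)\to\mathcal O$ as $\tau\to a$, and, with $\gamma(a)=\mathcal O$, $\gamma|_{[a,b]}$ is a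 future directed timelike curve in $M_{\rm ext}$ for all $b\in(a,d)$. (c) The Ricci tensor $\mathrm{Ric}$ of $(M,g)$, $\rho$ and $p$ extend continuously to $M\cup\{\mathcal O\}$. Assume moreover that at least one of the following holds: (d) $(M_{\rm ext},g_{\rm ext})$ is strongly causal at $\mathcal O$: every neighborhood $U$ of $\mathcal O$ contains a neighborhood $V$ of $\mathcal O$ such that every future directed causal curve in $M_{\rm ext}$ with both endpoints in $V$ lies in $U$; (d$'$) every neighborhood $U$ of $\mathcal O$ contains a neighborhood $V$ of $\mathcal O$ with $\partial^-M\cap V\subset J^+(\mathcal O,V)$. Then the continuous extension of $\mathrm{Ric}$ to $M\cup\{\mathcal O\}$ satisfies $$\widetilde{\mathrm{Ric}}(\mathcal O)=\frac{16\pi\,\widetilde\rho(\mathcal O)}{n-1}\,g_{\rm ext}(\mathcal O).$$ -/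

import Mathlib

open Set Filter Topology MeasureTheory
open scoped Manifold ContDiff

noncomputable section

namespace Cosmo

/-- The model space `ℝ^{n+1}`, with coordinates `x⁰, …, xⁿ`. -/
abbrev Coord (n : ℕ) : Type := EuclideanSpace ℝ (Fin (n + 1))

/-- The tangent space at a point of an `(n+1)`-dimensional manifold. -/
abbrev Tan (n : ℕ) {M : Type*} [TopologicalSpace M] [ChartedSpace (Coord n) M] (x : M) : Type :=
  TangentSpace 𝓘(ℝ, Coord n) x

/-- A covariant 2-tensor field: a bilinear form on each tangent space. -/
abbrev Tensor2 (n : ℕ) (M : Type*) [TopologicalSpace M] [ChartedSpace (Coord n) M] : Type _ :=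
  (x : M) → Tan n x →L[ℝ] Tan n x →L[ℝ] ℝ

/-- A (not necessarily continuous) vector field. -/
abbrev VField (n : ℕ) (M : Type*) [TopologicalSpace M] [ChartedSpace (Coord n) M] : Type _ :=
  (x : M) → Tan n x

section Coordinates

variable {n : ℕ} {M : Type*} [TopologicalSpace M] [ChartedSpace (Coord n) M]

/-- The smooth charts of `M`: all members of the maximal smooth atlas. -/
def smoothCharts (n : ℕ) (M : Type*) [TopologicalSpace M] [ChartedSpace (Coord n) M] :
    Set (OpenPartialHomeomorph M (Coord n)) :=
  IsManifold.maximalAtlas 𝓘(ℝ, Coord n) ∞ M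

/-- The coordinate one-form `dxⁱ` of the chart `φ` at `x`. -/
def dcoord (φ : OpenPartialHomeomorph M (Coord n)) (x : M) (i : Fin (n + 1)) : Tan n x →L[ℝ] ℝ :=
  (EuclideanSpace.proj i : Coord n →L[ℝ] ℝ).comp
    (mfderiv 𝓘(ℝ, Coord n) 𝓘(ℝ, Coord n) φ x : Tan n x →L[ℝ] Coord n)

/-- The coordinate vector `∂ᵢ` of the chart `φ` at `x`. -/
def partialVec (φ : OpenPartialHomeomorph M (Coord n)) (x : M) (i : Fin (n + 1)) : Tan n x :=
  (mfderiv 𝓘(ℝ, Coord n) 𝓘(ℝ, Coord n) φ x : Tan n x →L[ℝ] Coord n).inverse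
    (EuclideanSpace.single i (1 : ℝ))

/-- The component `T(∂ᵢ, ∂ⱼ)` of a 2-tensor in the chart `φ`, as a function on `M`
(meaningful on `φ.source`). -/
def comp2 (T : Tensor2 n M) (φ : OpenPartialHomeomorph M (Coord n)) (i j : Fin (n + 1)) (x : M) :
    ℝ :=
  T x (partialVec φ x i) (partialVec φ x j)

/-- The matrix `g_{ij}` of `g` in the chart `φ`, as a function of the coordinates. -/
def coordMatrix (g : Tensor2 n M) (φ : OpenPartialHomeomorph M (Coord n)) (y : Coord n) :
    Matrix (Fin (n + 1)) (Fin (n + 1)) ℝ :=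
  Matrix.of fun i j => comp2 g φ i j (φ.symm y)

end Coordinates

section Curvature

variable {n : ℕ}

/-- The partial derivative `∂f/∂xⁱ` at `y`. -/
def pd (i : Fin (n + 1)) (f : Coord n → ℝ) (y : Coord n) : ℝ :=
  fderiv ℝ f y (EuclideanSpace.single i (1 : ℝ))

/-- The Christoffel symbol
`Γᵏᵢⱼ = ½ gᵏˡ (∂ᵢ g_{jl} + ∂ⱼ g_{il} - ∂ₗ g_{ij})`. -/
def christoffel (G : Coord n → Matrix (Fin (n + 1)) (Fin (n + 1)) ℝ) (k i j : Fin (n + 1))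
    (y : Coord n) : ℝ :=
  (1 / 2) * ∑ l, (G y)⁻¹ k l *
    (pd i (fun z => G z j l) y + pd j (fun z => G z i l) y - pd l (fun z => G z i j) y)

/-- The Ricci component
`R_{ij} = ∂ₖ Γᵏᵢⱼ - ∂ᵢ Γᵏₖⱼ + Γᵏₖₗ Γˡᵢⱼ - Γᵏᵢₗ Γˡₖⱼ` (positive on round spheres). -/
def ricciCoord (G : Coord n → Matrix (Fin (n + 1)) (Fin (n + 1)) ℝ) (i j : Fin (n + 1))
    (y : Coord n) : ℝ :=
  ∑ k, (pd k (christoffel G k i j) y - pd i (christoffel G k k j) y)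
    + ∑ k, ∑ l, (christoffel G k k l y * christoffel G l i j y
        - christoffel G k i l y * christoffel G l k j y)

variable {M : Type*} [TopologicalSpace M] [ChartedSpace (Coord n) M]

/-- The Ricci tensor `Ric = R_{ij} dxⁱ ⊗ dxʲ`, computed at `x` in the preferred chart at `x`
(it does not depend on the chart wherever `g` is smooth). -/
def ricci (g : Tensor2 n M) : Tensor2 n M := fun x =>
  ∑ i, ∑ j, ricciCoord (coordMatrix g (chartAt (Coord n) x)) i j (chartAt (Coord n) x x) •
    (dcoord (chartAt (Coord n) x) x i).smulRight (dcoord (chartAt (Coord n) x) x j)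

/-- The scalar curvature `R = gⁱʲ R_{ij}`. -/
def scalarCurv (g : Tensor2 n M) (x : M) : ℝ :=
  ∑ i, ∑ j, (coordMatrix g (chartAt (Coord n) x) (chartAt (Coord n) x x))⁻¹ i j *
    ricciCoord (coordMatrix g (chartAt (Coord n) x)) i j (chartAt (Coord n) x x)

end Curvature

/-- A continuous spacetime of dimension `n + 1` on the manifold `M`: a continuous Lorentzian metric
of signature `(-, +, …, +)` together with a time orientation, given by a continuous timelike
vector field. -/
structure ContinuousSpacetime (n : ℕ) (M : Type*) [TopologicalSpace M]
    [ChartedSpace (Coord n) M] [IsManifold 𝓘(ℝ, Coord n) ∞ M] where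
  /-- the metric -/
  g : Tensor2 n M
  symm : ∀ (x : M) (v w : Tan n x), g x v w = g x w v
  lorentzian : ∀ x : M, ∃ b : Module.Basis (Fin (n + 1)) ℝ (Tan n x),
    ∀ i j, g x (b i) (b j) = if i = j then (if i = 0 then -1 else 1) else 0
  continuous_metric : ∀ φ ∈ smoothCharts n M, ∀ i j, ContinuousOn (comp2 g φ i j) φ.source
  /-- the vector field that defines the time orientation -/
  X : VField n M
  continuous_X : Continuous fun x => (⟨x, X x⟩ : TangentBundle 𝓘(ℝ, Coord n) M)
  timelike_X : ∀ x, g x (X x) (X x) < 0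

namespace ContinuousSpacetime

variable {n : ℕ} {M : Type*} [TopologicalSpace M] [ChartedSpace (Coord n) M]
  [IsManifold 𝓘(ℝ, Coord n) ∞ M]

/-- The metric is smooth on the set `N`: its components in all coordinates are. -/
def SmoothMetricOn (S : ContinuousSpacetime n M) (N : Set M) : Prop :=
  ∀ φ ∈ smoothCharts n M, ∀ i j,
    ContMDiffOn 𝓘(ℝ, Coord n) 𝓘(ℝ, ℝ) ∞ (comp2 S.g φ i j) (φ.source ∩ N)

/-- `v` is a future directed timelike vector. -/
def FutureTimelike (S : ContinuousSpacetime n M) {x : M} (v : Tan n x) : Prop :=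
  S.g x v v < 0 ∧ S.g x (S.X x) v < 0

/-- `v` is a future directed causal (timelike or null, nonzero) vector. -/
def FutureCausal (S : ContinuousSpacetime n M) {x : M} (v : Tan n x) : Prop :=
  v ≠ 0 ∧ S.g x v v ≤ 0 ∧ S.g x (S.X x) v < 0

end ContinuousSpacetime

section Curves

variable {n : ℕ} {M : Type*} [TopologicalSpace M] [ChartedSpace (Coord n) M]
  [IsManifold 𝓘(ℝ, Coord n) ∞ M]

/-- The velocity `γ'(t)` (equal to `0` where `γ` is not differentiable). -/
def velocity (n : ℕ) {M : Type*} [TopologicalSpace M] [ChartedSpace (Coord n) M] (γ : ℝ → M)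
    (t : ℝ) : Tan n (γ t) :=
  (mfderiv 𝓘(ℝ, ℝ) 𝓘(ℝ, Coord n) γ t : ℝ →L[ℝ] Tan n (γ t)) 1

/-- `γ : [a, b] → M` is a Lipschitz curve. As `[a, b]` is compact, being Lipschitz for the distance
of a Riemannian metric is the same as being continuous and locally Lipschitz in charts. -/
def LipschitzCurve (n : ℕ) {M : Type*} [TopologicalSpace M] [ChartedSpace (Coord n) M] (γ : ℝ → M)
    (a b : ℝ) : Prop :=
  ContinuousOn γ (Icc a b) ∧ ∀ t ∈ Icc a b, ∃ φ ∈ smoothCharts n M, γ t ∈ φ.source ∧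
    ∃ s ∈ 𝓝[Icc a b] t, ∃ K : NNReal, LipschitzOnWith K (φ ∘ γ) s

namespace ContinuousSpacetime

variable (S : ContinuousSpacetime n M)

/-- `γ : [a, b] → M` is a future directed timelike curve: it is Lipschitz, its velocity is future
directed timelike almost everywhere, and `g(γ', γ') < -ε` almost everywhere for some `ε > 0`. -/
def IsTimelikeCurve (γ : ℝ → M) (a b : ℝ) : Prop :=
  a < b ∧ LipschitzCurve n γ a b ∧ ∃ ε > 0, ∀ᵐ t ∂(volume.restrict (Icc a b)),
    S.FutureTimelike (velocity n γ t) ∧ S.g (γ t) (velocity n γ t) (velocity n γ t) < -ε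

/-- `γ : [a, b] → M` is a future directed causal curve. -/
def IsCausalCurve (γ : ℝ → M) (a b : ℝ) : Prop :=
  a < b ∧ LipschitzCurve n γ a b ∧ ∀ᵐ t ∂(volume.restrict (Icc a b)),
    S.FutureCausal (velocity n γ t)

/-- The timelike future `I⁺(p, U)`. -/
def timelikeFuture (p : M) (U : Set M) : Set M :=
  {q | ∃ (γ : ℝ → M) (a b : ℝ), S.IsTimelikeCurve γ a b ∧ MapsTo γ (Icc a b) U ∧
    γ a = p ∧ γ b = q}

/-- The causal future `J⁺(p, U)`; it contains `p`. -/
def causalFuture (p : M) (U : Set M) : Set M :=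
  {q | (q = p ∧ p ∈ U) ∨ ∃ (γ : ℝ → M) (a b : ℝ), S.IsCausalCurve γ a b ∧
    MapsTo γ (Icc a b) U ∧ γ a = p ∧ γ b = q}

/-- The past boundary `∂⁻N`: the points of `closure N \ N` from which a future directed timelike
curve enters `N` at once and stays in it. -/
def pastBoundary (N : Set M) : Set M :=
  {p | p ∈ closure N \ N ∧ ∃ (γ : ℝ → M) (a b : ℝ), S.IsTimelikeCurve γ a b ∧ γ a = p ∧
    ∀ t ∈ Ioc a b, γ t ∈ N}

/-- Strong causality at the point `o`. -/
def StronglyCausalAt (o : M) : Prop :=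
  ∀ U ∈ 𝓝 o, ∃ V ∈ 𝓝 o, V ⊆ U ∧ ∀ (γ : ℝ → M) (a b : ℝ), S.IsCausalCurve γ a b →
    γ a ∈ V → γ b ∈ V → MapsTo γ (Icc a b) U

/-- Near `o`, the past boundary of `N` lies in the local causal future of `o`. -/
def PastBoundaryLocallyInFuture (N : Set M) (o : M) : Prop :=
  ∀ U ∈ 𝓝 o, ∃ V ∈ 𝓝 o, V ⊆ U ∧ S.pastBoundary N ∩ V ⊆ S.causalFuture o V

/-- `(M, g)` is a continuous extension of the smooth spacetime `(N, g|_N)`: here `N` is identified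
with its image, which is open because the dimensions agree, and it carries the restricted metric
and time orientation. -/
structure IsContinuousExtensionOf (N : Set M) : Prop where
  isOpen : IsOpen N
  proper : N ≠ univ
  smooth : S.SmoothMetricOn N

/-- `(N, g|_N)` solves the Einstein equations with the perfect fluid `(u, ρ, p)`. Only the values
of `u`, `ρ`, `p` on `N` matter. -/
structure SolvesEinsteinPerfectFluid (N : Set M) (u : VField n M) (ρ p : M → ℝ) : Prop where
  smooth_u : ContMDiffOn 𝓘(ℝ, Coord n) 𝓘(ℝ, Coord n).tangent ∞
    (fun x => (⟨x, u x⟩ : TangentBundle 𝓘(ℝ, Coord n) M)) N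
  smooth_ρ : ContMDiffOn 𝓘(ℝ, Coord n) 𝓘(ℝ, ℝ) ∞ ρ N
  smooth_p : ContMDiffOn 𝓘(ℝ, Coord n) 𝓘(ℝ, ℝ) ∞ p N
  future_u : ∀ x ∈ N, S.FutureTimelike (u x)
  unit_u : ∀ x ∈ N, S.g x (u x) (u x) = -1
  einstein : ∀ x ∈ N, ∀ v w : Tan n x,
    ricci S.g x v w - (1 / 2) * scalarCurv S.g x * S.g x v w
      = 8 * Real.pi * ((ρ x + p x) * (S.g x (u x) v * S.g x (u x) w) + p x * S.g x v w)

/-- All integral curves of `u` in `N` have past endpoint `o`, and the curves extended by `o` are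
future directed timelike on compact domains: every integral curve on an interval `(c, d)` continues
to the past, as an integral curve in `N`, to an interval `(a, d)` at whose left end it converges
to `o`, and with the value `o` at `a` it is a future directed timelike curve on `[a, b]` for all
`b` in `(a, d)`. -/
def IntegralCurvesEmanateFrom (N : Set M) (u : VField n M) (o : M) : Prop :=
  ∀ (γ : ℝ → M) (c d : ℝ), c < d → MapsTo γ (Ioo c d) N →
    IsMIntegralCurveOn (I := 𝓘(ℝ, Coord n)) γ u (Ioo c d) →
    ∃ (Γ : ℝ → M) (a : ℝ), a ≤ c ∧ EqOn Γ γ (Ioo c d) ∧ MapsTo Γ (Ioo a d) N ∧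
      IsMIntegralCurveOn (I := 𝓘(ℝ, Coord n)) Γ u (Ioo a d) ∧
      Γ a = o ∧ Tendsto Γ (𝓝[>] a) (𝓝 o) ∧
      ∀ b ∈ Ioo a d, S.IsTimelikeCurve Γ a b

end ContinuousSpacetime

end Curves

section Extensions

variable {n : ℕ} {M : Type*} [TopologicalSpace M] [ChartedSpace (Coord n) M]

/-- `f'` is a continuous extension of the function `f` on `N` to `N ∪ {o}`. Only the values of
`f'` on `N ∪ {o}` matter. -/
def IsContExtFun (N : Set M) (o : M) (f f' : M → ℝ) : Prop :=
  EqOn f' f N ∧ ContinuousOn f' (insert o N)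

/-- `T'` is a continuous extension of the 2-tensor field `T` on `N` to `N ∪ {o}`: in some
coordinate neighborhood of `o` its components are continuous on `N ∪ {o}`. -/
def IsContExtTensor (N : Set M) (o : M) (T T' : Tensor2 n M) : Prop :=
  (∀ x ∈ N, T' x = T x) ∧ ∃ φ ∈ smoothCharts n M, o ∈ φ.source ∧
    ∀ i j, ContinuousOn (comp2 T' φ i j) (φ.source ∩ insert o N)

end Extensions

end Cosmo

end

/-! Taking the trace of the Einstein equations gives `Ric = 8π(ρ+p) u_*⊗u_* + 8π(ρ-p)/(n-1) g` on
`M`. The claim is therefore that `ρ+p` vanishes at `o` and that the first term tends to zero along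
some approach to `o`.

Suppose `ρ+p ≠ 0` at `o`. Dividing by it shows that `u_*⊗u_*` converges at `o`. The time orientation
fixes the sign, so `u` itself converges to a future directed unit timelike `w`
(`exists_tendsto_toCoord`). This is impossible (`IntegralCurvesEmanateFrom.mem_of_tendsto`). Leave
`o` along a short timelike segment whose direction is tilted away from `w`; its endpoint `q` lies in
`I⁺(o) = M`. Followed backwards from `q`, the integral curve of `u` runs nearly along `-w`. It
cannot arrive at `o` soon, since the chord from `o` to `q` has the wrong direction. So it continues
to a point near `o - s₀ w`, from which a nearly straight timelike segment leads back to `o`. As the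
curve itself starts at `o`, this closes a timelike loop, and `o ∈ I⁺(o) = M` contradicts `o ∈ ∂⁻M`.

Hence `ρ+p → 0`. Although `u` need not converge at `o`, it is bounded along a single integral curve,
because that curve is Lipschitz up to `o`. Along it the term `(ρ+p) u_*⊗u_*` vanishes in the limit,
and with `p = -ρ` at `o` the formula follows. -/

namespace Cosmo

/-! ### Tensors, vector fields and Lipschitz curves in coordinates. -/

section Charts

variable {n : ℕ} {M : Type*} [TopologicalSpace M] [ChartedSpace (Coord n) M] {φ : OpenPartialHomeomorph M (Coord n)}

/-- The coordinate representation of a tangent vector in the chart `φ`. -/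
noncomputable def toCoord (φ : OpenPartialHomeomorph M (Coord n)) (x : M) : Tan n x →L[ℝ] Coord n :=
  mfderiv 𝓘(ℝ, Coord n) 𝓘(ℝ, Coord n) φ x

lemma mdifferentiable_of_mem_smoothCharts (hφ : φ ∈ smoothCharts n M) :
    φ.MDifferentiable 𝓘(ℝ, Coord n) 𝓘(ℝ, Coord n) :=
  ⟨(contMDiffOn_of_mem_maximalAtlas hφ).mdifferentiableOn (by simp),
    (contMDiffOn_symm_of_mem_maximalAtlas hφ).mdifferentiableOn (by simp)⟩

lemma toCoord_isInvertible (hφ : φ ∈ smoothCharts n M) {x : M} (hx : x ∈ φ.source) :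
    (toCoord φ x).IsInvertible :=
  ⟨(mdifferentiable_of_mem_smoothCharts hφ).mfderiv hx, rfl⟩

lemma toCoord_partialVec (hφ : φ ∈ smoothCharts n M) {x : M} (hx : x ∈ φ.source)
    (i : Fin (n + 1)) : toCoord φ x (partialVec φ x i) = EuclideanSpace.single i (1 : ℝ) := by
  obtain ⟨e, he⟩ := toCoord_isInvertible hφ hx
  have h : partialVec φ x i = (toCoord φ x).inverse (EuclideanSpace.single i (1 : ℝ)) := rfl
  rw [h, ← he, ContinuousLinearMap.inverse_equiv]
  simp

lemma eq_sum_partialVec (hφ : φ ∈ smoothCharts n M) {x : M} (hx : x ∈ φ.source) (v : Tan n x) :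
    v = ∑ i, toCoord φ x v i • partialVec φ x i := by
  obtain ⟨e, he⟩ := toCoord_isInvertible hφ hx
  have hinj : Function.Injective (toCoord φ x) := by rw [← he]; exact e.injective
  apply hinj
  rw [map_sum]
  simp only [map_smul, toCoord_partialVec hφ hx]
  ext j
  simp [Finset.sum_apply, Pi.single_apply]

/-- The bilinear form with the components of `T` at `x` in the chart `φ`. -/
noncomputable def coordForm (T : Tensor2 n M) (φ : OpenPartialHomeomorph M (Coord n)) (x : M)
    (v w : Coord n) : ℝ :=
  ∑ i, ∑ j, comp2 T φ i j x * v i * w j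

lemma apply_eq_coordForm (T : Tensor2 n M) (hφ : φ ∈ smoothCharts n M) {x : M}
    (hx : x ∈ φ.source) (v w : Tan n x) :
    T x v w = coordForm T φ x (toCoord φ x v) (toCoord φ x w) := by
  conv_lhs => rw [eq_sum_partialVec hφ hx v, eq_sum_partialVec hφ hx w]
  simp only [map_sum, map_smul, sum_apply, smul_apply,
    coordForm, comp2, smul_eq_mul, Finset.mul_sum]
  rw [Finset.sum_comm]
  refine Finset.sum_congr rfl fun i _ => Finset.sum_congr rfl fun j _ => ?_
  ring

/-- The tangent space changes with the base point; in coordinates all these forms live on one fixed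
space, so base point and both arguments can vary together. -/
lemma tendsto_coordForm {α : Type*} {l : Filter α} {T : Tensor2 n M} {x : α → M} {x₀ : M}
    {v w : α → Coord n} {v₀ w₀ : Coord n}
    (hT : ∀ i j, Tendsto (fun a => comp2 T φ i j (x a)) l (𝓝 (comp2 T φ i j x₀)))
    (hv : Tendsto v l (𝓝 v₀)) (hw : Tendsto w l (𝓝 w₀)) :
    Tendsto (fun a => coordForm T φ (x a) (v a) (w a)) l (𝓝 (coordForm T φ x₀ v₀ w₀)) := by
  have hc (i : Fin (n + 1)) : Continuous fun z : Coord n => z i := by fun_prop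
  exact tendsto_finsetSum _ fun i _ => tendsto_finsetSum _ fun j _ =>
    ((hT i j).mul (((hc i).tendsto _).comp hv)).mul (((hc j).tendsto _).comp hw)

/-- The coordinates of the field are the fibre part of the tangent map of `φ` applied to a
continuous section, and the tangent map of a smooth chart is continuous. -/
lemma continuousAt_toCoord_field [IsManifold 𝓘(ℝ, Coord n) ∞ M] (hφ : φ ∈ smoothCharts n M) {X : VField n M}
    (hX : Continuous fun x => (⟨x, X x⟩ : TangentBundle 𝓘(ℝ, Coord n) M)) {x : M}
    (hx : x ∈ φ.source) : ContinuousAt (fun y => toCoord φ y (X y)) x := by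
  have h := (contMDiffOn_of_mem_maximalAtlas hφ).continuousOn_tangentMapWithin (by simp)
    φ.open_source.uniqueMDiffOn
  have h2 : ContinuousOn (fun y => tangentMapWithin 𝓘(ℝ, Coord n) 𝓘(ℝ, Coord n) φ φ.source
      (⟨y, X y⟩ : TangentBundle 𝓘(ℝ, Coord n) M)) φ.source :=
    h.comp hX.continuousOn fun y hy => hy
  have h3 := (tangentBundleModelSpaceHomeomorph 𝓘(ℝ, Coord n)).continuous.comp_continuousOn h2
  have h4 := (continuous_snd.comp_continuousOn h3).continuousAt (φ.open_source.mem_nhds hx)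
  refine h4.congr ?_
  filter_upwards [φ.open_source.mem_nhds hx] with y hy
  simp only [Function.comp, tangentBundleModelSpaceHomeomorph, tangentMapWithin]
  rw [mfderivWithin_eq_mfderiv (φ.open_source.uniqueMDiffOn y hy)
    ((mdifferentiable_of_mem_smoothCharts hφ).mdifferentiableAt hy)]
  rfl

/-- Being Lipschitz near a parameter value does not depend on the chart. -/
lemma LipschitzCurve.exists_lipschitzOnWith {γ : ℝ → M} {a b t : ℝ} (h : LipschitzCurve n γ a b)
    (ht : t ∈ Icc a b) (hφ : φ ∈ smoothCharts n M) (hx : γ t ∈ φ.source) :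
    ∃ s ∈ 𝓝[Icc a b] t, ∃ K : NNReal, LipschitzOnWith K (φ ∘ γ) s := by
  obtain ⟨hcont, h⟩ := h
  obtain ⟨ψ, hψ, hxψ, s, hs, K, hK⟩ := h t ht
  -- The transition map is C¹, hence locally Lipschitz, and carries the estimate from `ψ` to `φ`.
  have hsm : ContMDiffAt 𝓘(ℝ, Coord n) 𝓘(ℝ, Coord n) 1 (φ ∘ ψ.symm) (ψ (γ t)) := by
    refine ContMDiffAt.of_le (n := ∞) ?_ (by simp)
    refine ContMDiffAt.comp _ (I' := 𝓘(ℝ, Coord n)) ?_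
      (contMDiffAt_symm_of_mem_maximalAtlas hψ (ψ.map_source hxψ))
    rw [ψ.left_inv hxψ]
    exact contMDiffAt_of_mem_maximalAtlas hφ hx
  obtain ⟨K', t', ht', hL⟩ := hsm.contDiffAt.exists_lipschitzOnWith
  have hψγ : ContinuousWithinAt (ψ ∘ γ) (Icc a b) t :=
    (ψ.continuousAt hxψ).comp_continuousWithinAt (hcont t ht)
  refine ⟨s ∩ (γ ⁻¹' ψ.source ∩ (ψ ∘ γ) ⁻¹' t'), inter_mem hs (inter_mem
    ((hcont t ht).preimage_mem_nhdsWithin (ψ.open_source.mem_nhds hxψ))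
    (hψγ.preimage_mem_nhdsWithin ht')), K' * K, ?_⟩
  have := hL.comp (hK.mono (inter_subset_left (t := γ ⁻¹' ψ.source ∩ (ψ ∘ γ) ⁻¹' t')))
    (fun τ hτ => hτ.2.2)
  intro x hx y hy
  have h1 := this hx hy
  simpa [Function.comp, ψ.left_inv hx.2.1, ψ.left_inv hy.2.1] using h1

lemma hasDerivAt_chart_comp (hφ : φ ∈ smoothCharts n M) {γ : ℝ → M} {t : ℝ}
    {v : Tan n (γ t)} (hγ : HasMFDerivAt 𝓘(ℝ, ℝ) 𝓘(ℝ, Coord n) γ t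
      ((1 : ℝ →L[ℝ] ℝ).smulRight v)) (hx : γ t ∈ φ.source) :
    HasDerivAt (φ ∘ γ) (toCoord φ (γ t) v) t := by
  have h1 := ((mdifferentiable_of_mem_smoothCharts hφ).mdifferentiableAt hx).hasMFDerivAt
  have h2 : HasFDerivAt (φ ∘ γ)
      ((toCoord φ (γ t)).comp ((1 : ℝ →L[ℝ] ℝ).smulRight v) : ℝ →L[ℝ] Coord n) t :=
    hasMFDerivAt_iff_hasFDerivAt.1 (h1.comp t hγ)
  refine (h2.hasDerivAt).congr_deriv ?_
  change toCoord φ (γ t) (((1 : ℝ →L[ℝ] ℝ).smulRight v) (1 : ℝ)) = _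
  congr 1
  exact one_smul ℝ v

lemma toCoord_velocity (hφ : φ ∈ smoothCharts n M) {γ : ℝ → M} {t : ℝ}
    (hγ : MDifferentiableAt 𝓘(ℝ, ℝ) 𝓘(ℝ, Coord n) γ t) (hx : γ t ∈ φ.source) :
    toCoord φ (γ t) (velocity n γ t) = deriv (φ ∘ γ) t := by
  refine (hasDerivAt_chart_comp hφ ?_ hx).deriv.symm
  have h : ((1 : ℝ →L[ℝ] ℝ).smulRight (velocity n γ t) : ℝ →L[ℝ] Tan n (γ t))
      = mfderiv 𝓘(ℝ, ℝ) 𝓘(ℝ, Coord n) γ t :=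
    ContinuousLinearMap.ext_ring (one_smul ℝ (velocity n γ t))
  exact h ▸ hγ.hasMFDerivAt

/-- Along a Lipschitz integral curve of `u` that starts at `o`, the coordinates of `u` are bounded
near `o`. -/
lemma exists_bound_toCoord_of_lipschitz {u : VField n M} {o : M} (hφ : φ ∈ smoothCharts n M)
    (ho : o ∈ φ.source) {Γ : ℝ → M} {a b : ℝ} (hab : a < b) (hL : LipschitzCurve n Γ a b) (hΓa : Γ a = o)
    (hΓu : ∀ t ∈ Ioo a b, HasMFDerivAt 𝓘(ℝ, ℝ) 𝓘(ℝ, Coord n) Γ t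
      ((1 : ℝ →L[ℝ] ℝ).smulRight (u (Γ t)))) :
    ∃ C : ℝ, ∀ᶠ t in 𝓝[>] a, ‖toCoord φ (Γ t) (u (Γ t))‖ ≤ C := by
  obtain ⟨s, hs, K, hK⟩ := hL.exists_lipschitzOnWith (left_mem_Icc.2 hab.le) hφ (by rwa [hΓa])
  refine ⟨K, ?_⟩
  have hev : ∀ᶠ t in 𝓝[Icc a b] a, t ∈ s ∧ Γ t ∈ φ.source := by
    refine Filter.Eventually.and hs ?_
    exact (hL.1 a (left_mem_Icc.2 hab.le)).eventually_mem
      (φ.open_source.mem_nhds (by rwa [hΓa]))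
  rw [nhdsWithin_Icc_eq_nhdsGE hab] at hev
  obtain ⟨c, hc, hcs⟩ := mem_nhdsGE_iff_exists_Ico_subset.1 hev
  filter_upwards [Ioo_mem_nhdsGT (lt_min hab hc)] with t ht
  have htb : t < b := ht.2.trans_le (min_le_left _ _)
  have htc : t < c := ht.2.trans_le (min_le_right _ _)
  have hd := hasDerivAt_chart_comp hφ (hΓu t ⟨ht.1, htb⟩) (hcs ⟨ht.1.le, htc⟩).2
  -- The field is the derivative of the coordinate curve, so the Lipschitz constant near `a` bounds
  -- it.
  rw [← hd.deriv]
  exact norm_deriv_le_of_lipschitzOn (s := Ioo a c) (Ioo_mem_nhds ht.1 htc)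
    (hK.mono fun x hx => (hcs ⟨hx.1.le, hx.2⟩).1)

end Charts

end Cosmo

/-! ### Lorentzian linear algebra and the trace-reversed Einstein equations. -/

namespace Cosmo

namespace ContinuousSpacetime

variable {n : ℕ} {M : Type*} [TopologicalSpace M] [ChartedSpace (Coord n) M]
  [IsManifold 𝓘(ℝ, Coord n) ∞ M] (S : ContinuousSpacetime n M)
  {φ : OpenPartialHomeomorph M (Coord n)}

lemma exists_orthonormal_apply (x : M) :
    ∃ b : Module.Basis (Fin (n + 1)) ℝ (Tan n x),
      (∀ (i : Fin (n + 1)) (v : Tan n x), S.g x (b i) v = (if i = 0 then -1 else 1) * b.repr v i) ∧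
      ∀ v w : Tan n x, S.g x v w = ∑ i, (if i = 0 then -1 else 1) * b.repr v i * b.repr w i := by
  obtain ⟨b, hb⟩ := S.lorentzian x
  have h1 (i : Fin (n + 1)) (v : Tan n x) :
      S.g x (b i) v = (if i = 0 then -1 else 1) * b.repr v i := by
    conv_lhs => rw [← b.sum_repr v]
    simp only [map_sum, map_smul, hb, smul_eq_mul]
    rw [Finset.sum_eq_single i (fun j _ hj => by simp [hj.symm]) (by simp)]
    simp [mul_comm]
  refine ⟨b, h1, fun v w => ?_⟩
  conv_lhs => rw [← b.sum_repr v]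
  rw [map_sum, sum_apply]
  refine Finset.sum_congr rfl fun i _ => ?_
  rw [map_smul, smul_apply, h1, smul_eq_mul]
  ring

lemma eq_zero_of_forall_apply_eq_zero {x : M} {v : Tan n x} (h : ∀ w, S.g x w v = 0) : v = 0 := by
  obtain ⟨b, hb, -⟩ := S.exists_orthonormal_apply x
  refine b.ext_elem fun i => ?_
  have := hb i v
  rw [h] at this
  rcases eq_or_ne i 0 with rfl | hi
  · simpa using this.symm
  · simpa [hi] using this.symm

/-- The reverse Cauchy–Schwarz inequality for a unit timelike vector and a timelike vector. -/
lemma neg_apply_self_le_sq {x : M} {u X : Tan n x} (hu : S.g x u u = -1) (hX : S.g x X X < 0) :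
    -S.g x X X ≤ S.g x u X ^ 2 := by
  obtain ⟨b, -, hb⟩ := S.exists_orthonormal_apply x
  have hX0 : b.repr X 0 ≠ 0 := by
    intro h0
    refine not_le.2 hX ?_
    rw [hb]
    refine Finset.sum_nonneg fun i _ => ?_
    rcases eq_or_ne i 0 with rfl | hi
    · simp [h0]
    · simp [hi, mul_self_nonneg]
  -- This `s` kills the time component of `u + s X`, so its `g`-square is nonnegative. Multiplying
  -- the expanded square by `-g(X,X)` and completing the square gives the claim.
  set s : ℝ := -(b.repr u 0) / b.repr X 0 with hs
  have hv0 : b.repr (u + s • X) 0 = 0 := by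
    simp [hs, hX0]
  have hpos : 0 ≤ S.g x (u + s • X) (u + s • X) := by
    rw [hb]
    refine Finset.sum_nonneg fun i _ => ?_
    rcases eq_or_ne i 0 with rfl | hi
    · rw [hv0]; simp
    · simp only [hi, if_false, one_mul]
      exact mul_self_nonneg _
  have hexp : S.g x (u + s • X) (u + s • X)
      = -1 + 2 * s * S.g x u X + s ^ 2 * S.g x X X := by
    simp only [map_add, map_smul, add_apply, smul_apply, smul_eq_mul, hu,
      S.symm x X u]
    ring
  rw [hexp] at hpos
  nlinarith [sq_nonneg (s * S.g x X X + S.g x u X), mul_nonneg hpos (neg_nonneg.2 hX.le)]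

/-- The matrix of the metric at `x` in the chart `φ`. -/
noncomputable def gMatrix (φ : OpenPartialHomeomorph M (Coord n)) (x : M) :
    Matrix (Fin (n + 1)) (Fin (n + 1)) ℝ :=
  Matrix.of fun i j => comp2 S.g φ i j x

lemma apply_partialVec (hφ : φ ∈ smoothCharts n M) {x : M} (hx : x ∈ φ.source) (i : Fin (n + 1))
    (v : Tan n x) : S.g x (partialVec φ x i) v
      = (S.gMatrix φ x).mulVec (fun j => toCoord φ x v j) i := by
  conv_lhs => rw [eq_sum_partialVec hφ hx v]
  simp only [map_sum, map_smul, smul_eq_mul, Matrix.mulVec, dotProduct, gMatrix, Matrix.of_apply,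
    comp2]
  exact Finset.sum_congr rfl fun i _ => mul_comm _ _

/-- A kernel vector of the matrix is `g`-orthogonal to every tangent vector, which nondegeneracy
excludes. -/
lemma isUnit_det_gMatrix (hφ : φ ∈ smoothCharts n M) {x : M} (hx : x ∈ φ.source) :
    IsUnit (S.gMatrix φ x).det := by
  rw [isUnit_iff_ne_zero]
  intro hdet
  obtain ⟨z, hz, hGz⟩ := Matrix.exists_mulVec_eq_zero_iff.2 hdet
  obtain ⟨e, he⟩ := toCoord_isInvertible hφ hx
  set v : Tan n x := e.symm (WithLp.toLp 2 z) with hv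
  have hDv : toCoord φ x v = WithLp.toLp 2 z := by rw [← he, hv]; simp
  have hv0 : v = 0 := by
    refine S.eq_zero_of_forall_apply_eq_zero fun w => ?_
    rw [eq_sum_partialVec hφ hx w]
    simp only [map_sum, sum_apply, map_smul, smul_apply, S.apply_partialVec hφ hx, hDv, hGz]
    simp
  apply hz
  have : WithLp.toLp 2 z = (0 : Coord n) := by rw [← hDv, hv0, map_zero]
  simpa using congrArg WithLp.ofLp this

/-- `ricci` is computed in the preferred chart at `x`, where `dxⁱ` and `∂ⱼ` are dual. The trace can
be taken there; the resulting identity is tensorial and can then be read in any chart. -/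
lemma ricci_partialVec (g : Tensor2 n M) (x : M) (i j : Fin (n + 1)) :
    ricci g x (partialVec (chartAt (Coord n) x) x i) (partialVec (chartAt (Coord n) x) x j)
      = ricciCoord (coordMatrix g (chartAt (Coord n) x)) i j (chartAt (Coord n) x x) := by
  have hd (k l : Fin (n + 1)) : dcoord (chartAt (Coord n) x) x k
      (partialVec (chartAt (Coord n) x) x l) = if k = l then 1 else 0 := by
    have h := toCoord_partialVec (φ := chartAt (Coord n) x)
      (IsManifold.chart_mem_maximalAtlas (I := 𝓘(ℝ, Coord n)) (n := ∞) x)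
      (mem_chart_source (Coord n) x) l
    change toCoord (chartAt (Coord n) x) x (partialVec (chartAt (Coord n) x) x l) k = _
    rw [h]
    simp
  simp only [ricci, sum_apply, smul_apply, ContinuousLinearMap.smulRight_apply, hd, smul_eq_mul]
  simp

/-- The trace-reversed Einstein equations of a perfect fluid. -/
lemma SolvesEinsteinPerfectFluid.ricci_eq {S : ContinuousSpacetime n M} (hn : 2 ≤ n) {N : Set M}
    {u : VField n M} {ρ p : M → ℝ} (h : S.SolvesEinsteinPerfectFluid N u ρ p) {x : M} (hx : x ∈ N)
    (v w : Tan n x) :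
    ricci S.g x v w = 8 * Real.pi * (ρ x + p x) * (S.g x (u x) v * S.g x (u x) w)
      + 8 * Real.pi * (ρ x - p x) / ((n : ℝ) - 1) * S.g x v w := by
  have hφ : chartAt (Coord n) x ∈ smoothCharts n M :=
    IsManifold.chart_mem_maximalAtlas (I := 𝓘(ℝ, Coord n)) (n := ∞) x
  have hxφ := mem_chart_source (Coord n) x
  set φ := chartAt (Coord n) x with hφdef
  set G := S.gMatrix φ x with hG
  have hGc : coordMatrix S.g φ (φ x) = G := by
    ext i j
    simp [coordMatrix, hG, gMatrix, φ.left_inv hxφ]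
  have hdet := S.isUnit_det_gMatrix hφ hxφ
  set R := scalarCurv S.g x with hR
  set U : Fin (n + 1) → ℝ := fun j => toCoord φ x (u x) j with hU
  set ul : Fin (n + 1) → ℝ := fun i => S.g x (u x) (partialVec φ x i) with hul
  have hulU : ul = G.mulVec U := by
    ext i
    change S.g x (u x) (partialVec φ x i) = _
    rw [S.symm, S.apply_partialVec hφ hxφ]
  have hij (i j : Fin (n + 1)) : ricciCoord (coordMatrix S.g φ) i j (φ x)
      = (1 / 2 * R + 8 * Real.pi * p x) * G i j + 8 * Real.pi * (ρ x + p x) * (ul i * ul j) := by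
    have := h.einstein x hx (partialVec φ x i) (partialVec φ x j)
    rw [ricci_partialVec] at this
    have hgij : S.g x (partialVec φ x i) (partialVec φ x j) = G i j := rfl
    rw [hgij] at this
    linear_combination this
  have hGsymm : G.transpose = G := by
    ext i j
    exact S.symm x _ _
  have htr : ∑ i, ∑ j, G⁻¹ i j * G i j = (n : ℝ) + 1 := by
    have h1 : (G⁻¹ * G).trace = (n : ℝ) + 1 := by
      rw [Matrix.nonsing_inv_mul _ hdet, Matrix.trace_one]; simp
    rw [← h1]
    simp only [Matrix.trace, Matrix.diag, Matrix.mul_apply]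
    refine Finset.sum_congr rfl fun i _ => Finset.sum_congr rfl fun j _ => ?_
    congr 1
    exact congrFun (congrFun hGsymm j) i
  have huu : ∑ i, ∑ j, G⁻¹ i j * (ul i * ul j) = -1 := by
    have h1 : G⁻¹.mulVec ul = U := by
      rw [hulU, Matrix.mulVec_mulVec, Matrix.nonsing_inv_mul _ hdet, Matrix.one_mulVec]
    have h2 : S.g x (u x) (u x) = ∑ i, ul i * U i := by
      conv_lhs => enter [2]; rw [eq_sum_partialVec hφ hxφ (u x)]
      rw [map_sum]
      refine Finset.sum_congr rfl fun i _ => ?_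
      rw [map_smul, smul_eq_mul, mul_comm]
    rw [← h.unit_u x hx, h2]
    refine Finset.sum_congr rfl fun i _ => ?_
    rw [← h1, Matrix.mulVec, dotProduct, Finset.mul_sum]
    exact Finset.sum_congr rfl fun j _ => by ring
  -- The trace of the Einstein equations, using `gⁱʲ gᵢⱼ = n + 1` and `gⁱʲ uᵢ uⱼ = -1`. Solving it
  -- for the coefficient of `g` requires `n ≠ 1`.
  have hRval : R = (1 / 2 * R + 8 * Real.pi * p x) * ((n : ℝ) + 1)
      + 8 * Real.pi * (ρ x + p x) * (-1) := by
    conv_lhs => rw [hR, scalarCurv, ← hφdef, hGc]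
    simp only [hij]
    rw [← htr, ← huu, Finset.mul_sum, Finset.mul_sum, ← Finset.sum_add_distrib]
    refine Finset.sum_congr rfl fun i _ => ?_
    rw [Finset.mul_sum, Finset.mul_sum, ← Finset.sum_add_distrib]
    refine Finset.sum_congr rfl fun j _ => ?_
    ring
  have hn1 : (n : ℝ) - 1 ≠ 0 := by
    have : (2 : ℝ) ≤ n := by exact_mod_cast hn
    linarith
  have hhalf : 1 / 2 * R + 8 * Real.pi * p x = 8 * Real.pi * (ρ x - p x) / ((n : ℝ) - 1) := by
    rw [eq_div_iff hn1]
    linear_combination -hRval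
  have hE := h.einstein x hx v w
  rw [← hhalf]
  linear_combination hE

end ContinuousSpacetime

end Cosmo

/-! ### Backward drift of curves, gluing, and timelike coordinate segments. -/

namespace Cosmo

/-- A curve whose velocity in a chart stays `η`-close to `w` follows the line in direction `w`
backwards up to an error that grows with speed `η`; in particular it does not leave the chart. -/
lemma norm_chart_add_smul_le_of_deriv_near {E M : Type*} [NormedAddCommGroup E] [NormedSpace ℝ E]
    [ProperSpace E] [TopologicalSpace M] [T2Space M] {φ : OpenPartialHomeomorph M E} {γ : ℝ → M}
    {α β δ η : ℝ} {y₀ w : E} (hαβ : α ≤ β) (hγ : ContinuousOn γ (Icc α β))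
    (hball : Metric.ball y₀ δ ⊆ φ.target) (hη : 0 ≤ η)
    (hder : ∀ t ∈ Ioc α β, γ t ∈ φ.source → φ (γ t) ∈ Metric.ball y₀ δ →
      ∃ v, HasDerivAt (φ ∘ γ) v t ∧ ‖v - w‖ ≤ η)
    (hβ : γ β ∈ φ.source) (hsmall : ‖φ (γ β) - y₀‖ + (‖w‖ + η) * (β - α) < δ) :
    ∀ t ∈ Icc α β, γ t ∈ φ.source ∧ ‖φ (γ t) - φ (γ β) + (β - t) • w‖ ≤ η * (β - t) := by
  set r := ‖φ (γ β) - y₀‖ + (‖w‖ + η) * (β - α) with hr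
  have hsub : Metric.closedBall y₀ r ⊆ Metric.ball y₀ δ := Metric.closedBall_subset_ball hsmall
  -- `K` is compact, hence closed in the Hausdorff space `M`. This makes the set of good times
  -- closed, although the chart domain is only open.
  set K : Set M := φ.symm '' Metric.closedBall y₀ r with hK
  have hKc : IsClosed K := ((isCompact_closedBall y₀ r).image_of_continuousOn
    (φ.symm.continuousOn.mono (hsub.trans hball))).isClosed
  have hKs {x : M} (hx : x ∈ K) : x ∈ φ.source ∧ φ x ∈ Metric.closedBall y₀ r := by
    obtain ⟨y, hy, rfl⟩ := hx
    exact ⟨φ.map_target (hball (hsub hy)), by rwa [φ.right_inv (hball (hsub hy))]⟩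
  have hKmem {t : ℝ} (ht : t ∈ Icc α β) (hs : γ t ∈ φ.source)
      (hest : ‖φ (γ t) - φ (γ β) + (β - t) • w‖ ≤ η * (β - t)) : γ t ∈ K := by
    refine ⟨φ (γ t), ?_, φ.left_inv hs⟩
    rw [mem_closedBall_iff_norm]
    have h1 : φ (γ t) - y₀ = (φ (γ t) - φ (γ β) + (β - t) • w) + (φ (γ β) - y₀)
        - (β - t) • w := by abel
    have h2 : ‖(β - t) • w‖ = (β - t) * ‖w‖ := by
      rw [norm_smul, Real.norm_of_nonneg (sub_nonneg.2 ht.2)]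
    have h3 := norm_sub_le ((φ (γ t) - φ (γ β) + (β - t) • w) + (φ (γ β) - y₀)) ((β - t) • w)
    have h4 := norm_add_le (φ (γ t) - φ (γ β) + (β - t) • w) (φ (γ β) - y₀)
    rw [h1]
    have h5 : (‖w‖ + η) * (β - t) ≤ (‖w‖ + η) * (β - α) :=
      mul_le_mul_of_nonneg_left (by linarith [ht.1]) (by positivity)
    linarith
  set s : Set ℝ := {t | γ t ∈ K ∧ ‖φ (γ t) - φ (γ β) + (β - t) • w‖ ≤ η * (β - t)} with hs
  have hclosed : IsClosed (s ∩ Icc α β) := by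
    have hA : IsClosed (Icc α β ∩ γ ⁻¹' K) := hγ.preimage_isClosed_of_isClosed isClosed_Icc hKc
    have hcont : ContinuousOn (fun t => φ (γ t)) (Icc α β ∩ γ ⁻¹' K) :=
      φ.continuousOn.comp (hγ.mono inter_subset_left) fun t ht => (hKs ht.2).1
    have := hA.isClosed_le (f := fun t => ‖φ (γ t) - φ (γ β) + (β - t) • w‖)
      (g := fun t => η * (β - t))
      ((hcont.sub continuousOn_const).add (by fun_prop)).norm (by fun_prop)
    convert this using 1
    ext t
    simp only [hs, mem_inter_iff, mem_ofPred_eq, mem_preimage]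
    tauto
  have hβs : β ∈ s := by
    have hest : ‖φ (γ β) - φ (γ β) + (β - β) • w‖ ≤ η * (β - β) := by simp
    exact ⟨hKmem ⟨hαβ, le_rfl⟩ hβ hest, hest⟩
  have hmain : Icc α β ⊆ s := by
    -- Continuous induction running downwards from `β`.
    refine hclosed.Icc_subset_of_forall_exists_lt hβs ?_
    rintro t ⟨⟨htK, htest⟩, htI⟩ y hy
    have hopen : IsOpen (φ.source ∩ φ ⁻¹' Metric.ball y₀ δ) :=
      φ.isOpen_inter_preimage Metric.isOpen_ball
    have htO : γ t ∈ φ.source ∩ φ ⁻¹' Metric.ball y₀ δ :=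
      ⟨(hKs htK).1, hsub (hKs htK).2⟩
    have hev : ∀ᶠ τ in 𝓝[Icc α β] t, γ τ ∈ φ.source ∩ φ ⁻¹' Metric.ball y₀ δ :=
      (hγ t (Ioc_subset_Icc_self htI)).eventually_mem (hopen.mem_nhds htO)
    rw [eventually_nhdsWithin_iff, Metric.eventually_nhds_iff] at hev
    obtain ⟨ε, hε, hev⟩ := hev
    obtain ⟨t', ht'1, ht'2⟩ : ∃ t', max (max y α) (t - ε) < t' ∧ t' < t :=
      exists_between (max_lt (max_lt hy htI.1) (by linarith))
    have hyt : y < t' := lt_of_le_of_lt (le_trans (le_max_left _ _) (le_max_left _ _)) ht'1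
    have hαt : α < t' := lt_of_le_of_lt (le_trans (le_max_right _ _) (le_max_left _ _)) ht'1
    have hεt : t - ε < t' := lt_of_le_of_lt (le_max_right _ _) ht'1
    have hin (τ : ℝ) (hτ : τ ∈ Icc t' t) : γ τ ∈ φ.source ∩ φ ⁻¹' Metric.ball y₀ δ := by
      refine hev ?_ ⟨by linarith [hτ.1], hτ.2.trans htI.2⟩
      rw [Real.dist_eq, abs_lt]
      constructor <;> linarith [hτ.1, hτ.2]
    choose! v hv hvw using fun τ (hτ : τ ∈ Icc t' t) =>
      hder τ ⟨by linarith [hτ.1], hτ.2.trans htI.2⟩ (hin τ hτ).1 (hin τ hτ).2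
    -- Mean value inequality for the deviation of the curve from uniform motion with velocity `w`.
    have hmv := (convex_Icc t' t).norm_image_sub_le_of_norm_hasDerivWithin_le
      (f := fun τ => φ (γ τ) - τ • w) (f' := fun τ => v τ - (1 : ℝ) • w) (C := η)
      (fun τ hτ => ((hv τ hτ).sub ((hasDerivAt_id τ).smul_const w)).hasDerivWithinAt)
      (fun τ hτ => by simpa using hvw τ hτ)
      (right_mem_Icc.2 ht'2.le) (left_mem_Icc.2 ht'2.le)
    have hest : ‖φ (γ t') - φ (γ β) + (β - t') • w‖ ≤ η * (β - t') := by
      have h1 : φ (γ t') - φ (γ β) + (β - t') • w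
          = (φ (γ t) - φ (γ β) + (β - t) • w) + (φ (γ t') - t' • w - (φ (γ t) - t • w)) := by
        module
      have h2 : ‖t' - t‖ = t - t' := by
        rw [Real.norm_eq_abs, abs_of_neg (by linarith)]; ring
      rw [h2] at hmv
      rw [h1]
      refine (norm_add_le _ _).trans ?_
      linarith
    have hsrc := (hin t' (left_mem_Icc.2 ht'2.le)).1
    exact ⟨t', ⟨hKmem ⟨hαt.le, ht'2.le.trans htI.2⟩ hsrc hest, hest⟩, hyt.le, ht'2⟩
  exact fun t ht => ⟨(hKs (hmain ht).1).1, (hmain ht).2⟩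

/-- Points on opposite sides of `b` are compared through `b`, where distances on the line add up, so
the constant does not grow. -/
lemma lipschitzOnWith_union_of_le_of_ge {E : Type*} [PseudoEMetricSpace E] {f : ℝ → E}
    {s t : Set ℝ} {b : ℝ} {K : NNReal} (hs : LipschitzOnWith K f s) (ht : LipschitzOnWith K f t)
    (hsb : ∀ x ∈ s, x ≤ b) (htb : ∀ x ∈ t, b ≤ x) (hbs : b ∈ s) (hbt : b ∈ t) :
    LipschitzOnWith K f (s ∪ t) := by
  have key {x y : ℝ} (hx : x ∈ s) (hy : y ∈ t) : edist (f x) (f y) ≤ K * edist x y := by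
    have h : edist x y = edist x b + edist b y := by
      have h1 := hsb x hx
      have h2 := htb y hy
      rw [edist_dist, edist_dist, edist_dist, ← ENNReal.ofReal_add dist_nonneg dist_nonneg,
        Real.dist_eq, Real.dist_eq, Real.dist_eq, abs_of_nonpos (by linarith),
        abs_of_nonpos (by linarith), abs_of_nonpos (by linarith)]
      ring_nf
    calc edist (f x) (f y) ≤ edist (f x) (f b) + edist (f b) (f y) := edist_triangle _ _ _
      _ ≤ K * edist x b + K * edist b y := add_le_add (hs hx hbs) (ht hbt hy)
      _ = K * edist x y := by rw [h, mul_add]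
  rintro x (hx | hx) y (hy | hy)
  · exact hs hx hy
  · exact key hx hy
  · rw [edist_comm, edist_comm x]
    exact key hy hx
  · exact ht hx hy

section Curves

variable {n : ℕ} {M : Type*} [TopologicalSpace M] [ChartedSpace (Coord n) M]
  {φ : OpenPartialHomeomorph M (Coord n)}

lemma LipschitzCurve.congr {γ γ' : ℝ → M} {a b : ℝ} (h : LipschitzCurve n γ a b)
    (hγ : EqOn γ' γ (Icc a b)) : LipschitzCurve n γ' a b := by
  refine ⟨h.1.congr hγ, fun t ht => ?_⟩
  obtain ⟨φ, hφ, hx, s, hs, K, hK⟩ := h.2 t ht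
  refine ⟨φ, hφ, by rwa [hγ ht], s ∩ Icc a b, inter_mem hs self_mem_nhdsWithin, K, ?_⟩
  intro x hx y hy
  simpa [Function.comp, hγ hx.2, hγ hy.2] using hK hx.1 hy.1

lemma LipschitzCurve.union {γ : ℝ → M} {a b c : ℝ} (hab : a ≤ b) (hbc : b ≤ c)
    (h₁ : LipschitzCurve n γ a b) (h₂ : LipschitzCurve n γ b c) : LipschitzCurve n γ a c := by
  have hU : Icc a c = Icc a b ∪ Icc b c := (Icc_union_Icc_eq_Icc hab hbc).symm
  refine ⟨hU ▸ h₁.1.union_of_isClosed h₂.1 isClosed_Icc isClosed_Icc, fun t ht => ?_⟩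
  rcases lt_trichotomy t b with htb | rfl | htb
  · have he : 𝓝[Icc a b] t = 𝓝[Icc a c] t :=
      nhdsWithin_eq_nhdsWithin (s := Iio b) htb isOpen_Iio (by
        ext x; simp only [mem_inter_iff, mem_Icc, mem_Iio]
        constructor <;> rintro ⟨⟨h1, h2⟩, h3⟩ <;> exact ⟨⟨h1, by linarith⟩, h3⟩)
    exact he ▸ h₁.2 t ⟨ht.1, htb.le⟩
  · obtain ⟨φ, hφ, hx, s, hs, K, hK⟩ := h₁.2 t ⟨hab, le_rfl⟩
    -- At the junction both pieces have to be Lipschitz in the same chart.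
    obtain ⟨s', hs', K', hK'⟩ := h₂.exists_lipschitzOnWith ⟨le_rfl, hbc⟩ hφ hx
    refine ⟨φ, hφ, hx, (s ∩ Icc a t) ∪ (s' ∩ Icc t c), ?_, max K K', ?_⟩
    · rw [hU, nhdsWithin_union]
      exact ⟨mem_of_superset (inter_mem hs self_mem_nhdsWithin) subset_union_left,
        mem_of_superset (inter_mem hs' self_mem_nhdsWithin) subset_union_right⟩
    · exact lipschitzOnWith_union_of_le_of_ge
        ((hK.mono inter_subset_left).weaken (le_max_left _ _))
        ((hK'.mono inter_subset_left).weaken (le_max_right _ _))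
        (fun x hx => hx.2.2) (fun x hx => hx.2.1)
        ⟨mem_of_mem_nhdsWithin (right_mem_Icc.2 hab) hs, hab, le_rfl⟩
        ⟨mem_of_mem_nhdsWithin (left_mem_Icc.2 hbc) hs', le_rfl, hbc⟩
  · have he : 𝓝[Icc b c] t = 𝓝[Icc a c] t :=
      nhdsWithin_eq_nhdsWithin (s := Ioi b) htb isOpen_Ioi (by
        ext x; simp only [mem_inter_iff, mem_Icc, mem_Ioi]
        constructor <;> rintro ⟨⟨h1, h2⟩, h3⟩ <;> exact ⟨⟨by linarith, h2⟩, h3⟩)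
    exact he ▸ h₂.2 t ⟨htb.le, ht.2⟩

variable [IsManifold 𝓘(ℝ, Coord n) ∞ M]

namespace ContinuousSpacetime

variable (S : ContinuousSpacetime n M)

/-- Velocity depends only on the germ of the curve. The two velocities have different tangent spaces
as types, so the base point has to be transported explicitly. -/
lemma timelike_velocity_congr {γ γ' : ℝ → M} {t ε : ℝ} (h : γ' =ᶠ[𝓝 t] γ)
    (hγ : S.FutureTimelike (velocity n γ t) ∧ S.g (γ t) (velocity n γ t) (velocity n γ t) < -ε) :
    S.FutureTimelike (velocity n γ' t) ∧
      S.g (γ' t) (velocity n γ' t) (velocity n γ' t) < -ε := by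
  have hv : ∀ x y : M, x = y → ∀ v : Coord n,
      (S.FutureTimelike (x := x) v ∧ S.g x v v < -ε) →
      (S.FutureTimelike (x := y) v ∧ S.g y v v < -ε) := by
    rintro x y rfl v hv
    exact hv
  have hvel : (velocity n γ' t : Coord n) = velocity n γ t := by
    unfold velocity
    exact congrArg (fun L : ℝ →L[ℝ] Coord n => L 1) h.mfderiv_eq
  have h1 := hv (γ t) (γ' t) h.eq_of_nhds.symm (velocity n γ t) hγ
  have h2 : ∀ v w : Tan n (γ' t), v = w → (S.FutureTimelike w ∧ S.g (γ' t) w w < -ε) →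
      (S.FutureTimelike v ∧ S.g (γ' t) v v < -ε) := by
    rintro v w rfl h
    exact h
  exact h2 _ _ hvel h1

variable {S}

lemma IsTimelikeCurve.concat {γ₁ γ₂ : ℝ → M} {a b c : ℝ} (h₁ : S.IsTimelikeCurve γ₁ a b)
    (h₂ : S.IsTimelikeCurve γ₂ b c) (hb : γ₁ b = γ₂ b) :
    S.IsTimelikeCurve (fun t => if t ≤ b then γ₁ t else γ₂ t) a c := by
  obtain ⟨hab, hL₁, ε₁, hε₁, hv₁⟩ := h₁
  obtain ⟨hbc, hL₂, ε₂, hε₂, hv₂⟩ := h₂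
  set γ : ℝ → M := fun t => if t ≤ b then γ₁ t else γ₂ t with hγ
  have e₁ : EqOn γ γ₁ (Iic b) := fun t ht => if_pos ht
  have e₂ : EqOn γ γ₂ (Ici b) := fun t ht => by
    rcases (mem_Ici.1 ht).eq_or_lt with rfl | h
    · simp [hγ, hb]
    · exact if_neg (not_le.2 h)
  refine ⟨hab.trans hbc, LipschitzCurve.union hab.le hbc.le
    (hL₁.congr (e₁.mono Icc_subset_Iic_self)) (hL₂.congr (e₂.mono Icc_subset_Ici_self)),
    min ε₁ ε₂, lt_min hε₁ hε₂, ?_⟩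
  rw [ae_restrict_iff' measurableSet_Icc] at hv₁ hv₂ ⊢
  -- The curve may have a corner at the junction, which is a null set.
  have hne : ∀ᵐ t : ℝ, t ≠ b := by
    simp [ae_iff]
  filter_upwards [hv₁, hv₂, hne] with t ht₁ ht₂ htb ht
  rcases lt_or_gt_of_ne htb with h | h
  · refine S.timelike_velocity_congr (γ := γ₁)
      (e₁.eventuallyEq_of_mem (Iic_mem_nhds h)) ?_
    obtain ⟨h1, h2⟩ := ht₁ ⟨ht.1, h.le⟩
    exact ⟨h1, h2.trans_le (neg_le_neg (min_le_left _ _))⟩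
  · refine S.timelike_velocity_congr (γ := γ₂)
      (e₂.eventuallyEq_of_mem (Ici_mem_nhds h)) ?_
    obtain ⟨h1, h2⟩ := ht₂ ⟨h.le, ht.2⟩
    exact ⟨h1, h2.trans_le (neg_le_neg (min_le_right _ _))⟩

/-- A coordinate segment with uniformly timelike direction is a timelike curve. -/
lemma isTimelikeCurve_segment (hφ : φ ∈ smoothCharts n M) {y w : Coord n} {a b ε : ℝ}
    (hab : a < b) (hε : 0 < ε) (hT : ∀ t ∈ Icc a b, y + t • w ∈ φ.target)
    (hw : ∀ t ∈ Icc a b, coordForm S.g φ (φ.symm (y + t • w)) w w < -ε)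
    (hX : ∀ t ∈ Icc a b, coordForm S.g φ (φ.symm (y + t • w))
      (toCoord φ (φ.symm (y + t • w)) (S.X (φ.symm (y + t • w)))) w < 0) :
    S.IsTimelikeCurve (fun t => φ.symm (y + t • w)) a b := by
  set σ : ℝ → M := fun t => φ.symm (y + t • w) with hσ
  have hline : Continuous fun t : ℝ => y + t • w := by fun_prop
  refine ⟨hab, ⟨φ.symm.continuousOn.comp hline.continuousOn hT, fun t ht => ?_⟩, ε, hε, ?_⟩
  · refine ⟨φ, hφ, φ.map_target (hT t ht), Icc a b, self_mem_nhdsWithin, ‖w‖₊, ?_⟩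
    refine LipschitzOnWith.of_dist_le_mul fun s hs s' hs' => ?_
    simp only [Function.comp, hσ, φ.right_inv (hT s hs), φ.right_inv (hT s' hs')]
    rw [dist_add_left, dist_eq_norm, ← sub_smul, norm_smul, dist_eq_norm, mul_comm]
    rfl
  · rw [ae_restrict_iff' measurableSet_Icc]
    refine Eventually.of_forall fun t ht => ?_
    have hsrc : σ t ∈ φ.source := φ.map_target (hT t ht)
    have hd : MDifferentiableAt 𝓘(ℝ, ℝ) 𝓘(ℝ, Coord n) σ t := by
      have h1 : MDifferentiableAt 𝓘(ℝ, ℝ) 𝓘(ℝ, Coord n) (fun t : ℝ => y + t • w) t :=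
        DifferentiableAt.mdifferentiableAt (by fun_prop)
      exact ((mdifferentiable_of_mem_smoothCharts hφ).mdifferentiableAt_symm (hT t ht)).comp t h1
    have hvel : toCoord φ (σ t) (velocity n σ t) = w := by
      rw [toCoord_velocity hφ hd hsrc]
      have h1 : φ ∘ σ =ᶠ[𝓝 t] fun t => y + t • w := by
        filter_upwards [hline.continuousAt.preimage_mem_nhds
          (φ.open_target.mem_nhds (hT t ht))] with s hs
        exact φ.right_inv hs
      rw [h1.deriv_eq]
      have h2 : HasDerivAt (fun t : ℝ => y + t • w) ((1 : ℝ) • w) t :=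
        ((hasDerivAt_id t).smul_const w).const_add y
      rw [h2.deriv, one_smul]
    have hgv : S.g (σ t) (velocity n σ t) (velocity n σ t) < -ε := by
      rw [apply_eq_coordForm S.g hφ hsrc, hvel]
      exact hw t ht
    refine ⟨⟨hgv.trans (by linarith), ?_⟩, hgv⟩
    rw [apply_eq_coordForm S.g hφ hsrc, hvel]
    exact hX t ht

end ContinuousSpacetime

end Curves

end Cosmo

/-! ### The limit of `u` at `o`, and the Euclidean estimate that contradicts it. -/

namespace Cosmo

lemma continuousAt_matrix_inv {m : Type*} [Fintype m] [DecidableEq m] {A : Matrix m m ℝ}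
    (hA : IsUnit A.det) : ContinuousAt (fun B : Matrix m m ℝ => B⁻¹) A := by
  simp only [Matrix.inv_def, Ring.inverse_eq_inv']
  have h1 : Continuous fun B : Matrix m m ℝ => B.det := continuous_id.matrix_det
  have h2 : Continuous fun B : Matrix m m ℝ => B.adjugate := continuous_id.matrix_adjugate
  exact (h1.continuousAt.inv₀ hA.ne_zero).smul h2.continuousAt

/-- If `τ (w + θ e)` lies within `η s` of `s w`, where `e` is a unit vector orthogonal to `w`, then
`η` is not small compared with `θ` and `w`. -/
lemma half_le_of_norm_smul_sub_smul_le {E : Type*} [NormedAddCommGroup E] [InnerProductSpace ℝ E]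
    {e w : E} {s τ θ η : ℝ} (hw : w ≠ 0) (he : ‖e‖ = 1) (hew : inner ℝ w e = 0) (hs : 0 < s)
    (hθ : 0 < θ) (hη : η ≤ ‖w‖ / 2) (h : ‖s • w - τ • (w + θ • e)‖ ≤ η * s) : θ / 2 ≤ η := by
  have hw' : 0 < ‖w‖ := norm_pos_iff.2 hw
  -- The component along `e` bounds `τθ`. The component along `w` then forces `τ ≥ s/2`, and the two
  -- combine to the claim.
  have h1 : τ * θ ≤ η * s := by
    have h2 := (abs_real_inner_le_norm e (s • w - τ • (w + θ • e)))
    have h3 : inner ℝ e (s • w - τ • (w + θ • e)) = -(τ * θ) := by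
      simp only [inner_sub_right, inner_smul_right, inner_add_right, real_inner_self_eq_norm_sq, he,
        real_inner_comm w e, hew]
      ring
    rw [h3, he, abs_neg, one_mul] at h2
    exact (le_abs_self _).trans (h2.trans h)
  have h4 : (s - τ) * ‖w‖ ≤ η * s := by
    have h2 := (le_abs_self _).trans (abs_real_inner_le_norm w (s • w - τ • (w + θ • e)))
    have h3 : inner ℝ w (s • w - τ • (w + θ • e)) = (s - τ) * ‖w‖ * ‖w‖ := by
      simp only [inner_sub_right, inner_smul_right, inner_add_right, real_inner_self_eq_norm_sq,
        hew]
      ring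
    rw [h3, mul_comm ‖w‖] at h2
    exact (le_of_mul_le_mul_right h2 hw').trans h
  have h5 : s / 2 ≤ τ := by
    have : (s - τ) * ‖w‖ ≤ (s / 2) * ‖w‖ := h4.trans (by nlinarith)
    have := le_of_mul_le_mul_right this hw'
    linarith
  have h6 : (θ / 2) * s ≤ η * s := by nlinarith
  exact le_of_mul_le_mul_right h6 hs

lemma exists_norm_eq_one_inner_eq_zero {n : ℕ} (hn : 1 ≤ n) {w : Coord n} (hw : w ≠ 0) :
    ∃ e : Coord n, ‖e‖ = 1 ∧ inner ℝ w e = 0 := by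
  have : Fact (Module.finrank ℝ (Coord n) = n + 1) := ⟨by simp⟩
  have hfr : Module.finrank ℝ (Submodule.span ℝ {w})ᗮ = n :=
    Submodule.finrank_orthogonal_span_singleton hw
  have : Nontrivial (Submodule.span ℝ {w})ᗮ := Module.nontrivial_of_finrank_pos (R := ℝ) (by omega)
  obtain ⟨e, he⟩ := exists_norm_eq (Submodule.span ℝ {w})ᗮ zero_le_one
  exact ⟨e, he, Submodule.mem_orthogonal_singleton_iff_inner_right.1 e.2⟩

namespace ContinuousSpacetime

variable {n : ℕ} {M : Type*} [TopologicalSpace M] [ChartedSpace (Coord n) M]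
  [IsManifold 𝓘(ℝ, Coord n) ∞ M] {S : ContinuousSpacetime n M}
  {φ : OpenPartialHomeomorph M (Coord n)} {N : Set M} {u : VField n M} {o : M}

/-- Through every point of `N` passes an integral curve of `u` that emanates from `o`. -/
lemma IntegralCurvesEmanateFrom.exists_curve (h : S.IntegralCurvesEmanateFrom N u o)
    (hN : IsOpen N)
    (hu : ContMDiffOn 𝓘(ℝ, Coord n) 𝓘(ℝ, Coord n).tangent ∞
      (fun x => (⟨x, u x⟩ : TangentBundle 𝓘(ℝ, Coord n) M)) N) {q : M} (hq : q ∈ N) :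
    ∃ (Γ : ℝ → M) (a t₀ d : ℝ), t₀ ∈ Ioo a d ∧ Γ t₀ = q ∧ MapsTo Γ (Ioo a d) N ∧
      (∀ t ∈ Ioo a d, HasMFDerivAt 𝓘(ℝ, ℝ) 𝓘(ℝ, Coord n) Γ t
        ((1 : ℝ →L[ℝ] ℝ).smulRight (u (Γ t)))) ∧
      Γ a = o ∧ Tendsto Γ (𝓝[>] a) (𝓝 o) ∧ ∀ b ∈ Ioo a d, S.IsTimelikeCurve Γ a b := by
  have : IsManifold 𝓘(ℝ, Coord n) 1 M := IsManifold.of_le (n := ∞) (by simp)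
  have hu1 : ContMDiffAt 𝓘(ℝ, Coord n) 𝓘(ℝ, Coord n).tangent 1
      (fun x => (⟨x, u x⟩ : TangentBundle 𝓘(ℝ, Coord n) M)) q :=
    (hu.contMDiffAt (hN.mem_nhds hq)).of_le (by simp)
  obtain ⟨γ, hγ0, hγ⟩ := exists_isMIntegralCurveAt_of_contMDiffAt_boundaryless (t₀ := 0) hu1
  have hmem : ∀ᶠ t in 𝓝 (0 : ℝ), γ t ∈ N :=
    hγ.continuousAt.eventually_mem (hN.mem_nhds (by rwa [hγ0]))
  obtain ⟨ε, hε, hball⟩ := Metric.eventually_nhds_iff_ball.1 (hmem.and hγ)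
  rw [Real.ball_eq_Ioo, zero_sub, zero_add] at hball
  obtain ⟨Γ, a, ha, hΓγ, hΓN, hΓu, hΓa, hΓlim, hΓt⟩ := h γ (-ε) ε (by linarith)
    (fun t ht => (hball t ht).1) (fun t ht => (hball t ht).2.hasMFDerivWithinAt)
  exact ⟨Γ, a, 0, ε, ⟨by linarith, hε⟩, by rw [hΓγ ⟨by linarith, hε⟩, hγ0], hΓN,
    fun t ht => (hΓu t ht).hasMFDerivAt (Ioo_mem_nhds ht.1 ht.2), hΓa, hΓlim, hΓt⟩

lemma continuousAt_comp2 (S : ContinuousSpacetime n M) (hφ : φ ∈ smoothCharts n M) {x : M}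
    (hx : x ∈ φ.source) (i j : Fin (n + 1)) : ContinuousAt (comp2 S.g φ i j) x :=
  (S.continuous_metric φ hφ i j).continuousAt (φ.open_source.mem_nhds hx)

/-- If the components of `u_* ⊗ u_*` converge at `o`, then so do those of the future directed unit
timelike field `u`, and the limit is future directed unit timelike. -/
lemma exists_tendsto_toCoord (hφ : φ ∈ smoothCharts n M) (ho : o ∈ φ.source)
    (hoN : o ∈ closure N) (hfut : ∀ x ∈ N, S.FutureTimelike (u x))
    (hunit : ∀ x ∈ N, S.g x (u x) (u x) = -1) {A : Fin (n + 1) → Fin (n + 1) → ℝ}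
    (hA : ∀ i j, Tendsto (fun x => S.g x (u x) (partialVec φ x i) * S.g x (u x) (partialVec φ x j))
      (𝓝[N] o) (𝓝 (A i j))) :
    ∃ w : Coord n, Tendsto (fun x => toCoord φ x (u x)) (𝓝[N] o) (𝓝 w) ∧
      coordForm S.g φ o w w = -1 ∧ coordForm S.g φ o (toCoord φ o (S.X o)) w < 0 := by
  have : (𝓝[N] o).NeBot := mem_closure_iff_nhdsWithin_neBot.1 hoN
  have hsrc : ∀ᶠ x in 𝓝[N] o, x ∈ φ.source := nhdsWithin_le_nhds (φ.open_source.mem_nhds ho)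
  have hNev : ∀ᶠ x in 𝓝[N] o, x ∈ N := self_mem_nhdsWithin
  set ξ : M → Coord n := fun x => toCoord φ x (S.X x) with hξ
  set ul : M → Fin (n + 1) → ℝ := fun x i => S.g x (u x) (partialVec φ x i) with hul
  have hξlim : Tendsto ξ (𝓝[N] o) (𝓝 (ξ o)) :=
    (continuousAt_toCoord_field hφ S.continuous_X ho).mono_left nhdsWithin_le_nhds
  have hξi (i : Fin (n + 1)) : Tendsto (fun x => ξ x i) (𝓝[N] o) (𝓝 (ξ o i)) := by
    have hc : Continuous fun z : Coord n => z i := by fun_prop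
    exact (hc.tendsto _).comp hξlim
  have hg (i j : Fin (n + 1)) : Tendsto (comp2 S.g φ i j) (𝓝[N] o) (𝓝 (comp2 S.g φ i j o)) :=
    (S.continuousAt_comp2 hφ ho i j).mono_left nhdsWithin_le_nhds
  set α : M → ℝ := fun x => S.g x (u x) (S.X x) with hα
  have hαsum : ∀ᶠ x in 𝓝[N] o, ∑ i, ξ x i * ul x i = α x := by
    filter_upwards [hsrc] with x hx
    conv_rhs => rw [hα]; dsimp only; rw [eq_sum_partialVec hφ hx (S.X x)]
    simp [map_sum, hξ, hul]
  have hαneg : ∀ᶠ x in 𝓝[N] o, α x < 0 := by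
    filter_upwards [hNev] with x hx
    rw [hα]
    dsimp only
    rw [S.symm]
    exact (hfut x hx).2
  -- Contracting `u_*⊗u_*` once with the continuous field `X` gives `α u_*`, and contracting twice
  -- gives `α²`, where `α = g(u, X)`.
  have hrow (i : Fin (n + 1)) : Tendsto (fun x => ul x i * α x) (𝓝[N] o)
      (𝓝 (∑ j, ξ o j * A i j)) := by
    refine (tendsto_finsetSum _ fun j _ => (hξi j).mul (hA i j)).congr' ?_
    filter_upwards [hαsum] with x hx
    rw [← hx, Finset.mul_sum]
    exact Finset.sum_congr rfl fun j _ => by simp only [hul]; ring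
  set L : ℝ := ∑ i, ξ o i * ∑ j, ξ o j * A i j with hL
  have hsq : Tendsto (fun x => α x ^ 2) (𝓝[N] o) (𝓝 L) := by
    refine (tendsto_finsetSum _ fun i _ => (hξi i).mul (hrow i)).congr' ?_
    filter_upwards [hαsum] with x hx
    rw [sq]
    nth_rewrite 2 [← hx]
    rw [Finset.sum_mul]
    exact Finset.sum_congr rfl fun i _ => by ring
  -- The reverse Cauchy–Schwarz inequality keeps `α²` away from zero.
  have hLpos : 0 < L := by
    have h1 : Tendsto (fun x => -coordForm S.g φ x (ξ x) (ξ x)) (𝓝[N] o)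
        (𝓝 (-coordForm S.g φ o (ξ o) (ξ o))) := (tendsto_coordForm hg hξlim hξlim).neg
    have h2 : -coordForm S.g φ o (ξ o) (ξ o) ≤ L := by
      refine le_of_tendsto_of_tendsto h1 hsq ?_
      filter_upwards [hsrc, hNev] with x hx hxN
      rw [hξ, ← apply_eq_coordForm S.g hφ hx]
      exact S.neg_apply_self_le_sq (hunit x hxN) (S.timelike_X x)
    have h3 := S.timelike_X o
    rw [apply_eq_coordForm S.g hφ ho] at h3
    linarith
  -- Future directedness means `α < 0` and selects the root. Dividing `α u_*` by `α` gives the limit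
  -- of `u_*`, and the inverse metric raises the index.
  have hαlim : Tendsto α (𝓝[N] o) (𝓝 (-√L)) := by
    refine ((Real.continuous_sqrt.tendsto L).comp hsq).neg.congr' ?_
    filter_upwards [hαneg] with x hx
    simp only [Function.comp]
    rw [Real.sqrt_sq_eq_abs, abs_of_neg hx, neg_neg]
  have hne : -√L ≠ 0 := neg_ne_zero.2 (Real.sqrt_pos.2 hLpos).ne'
  have hullim (i : Fin (n + 1)) : Tendsto (fun x => ul x i) (𝓝[N] o)
      (𝓝 ((∑ j, ξ o j * A i j) / -√L)) := by
    refine ((hrow i).div hαlim hne).congr' ?_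
    filter_upwards [hαneg] with x hx
    simp only [Pi.div_apply]
    exact mul_div_cancel_right₀ _ hx.ne
  have hinv : Tendsto (fun x => (S.gMatrix φ x)⁻¹) (𝓝[N] o) (𝓝 (S.gMatrix φ o)⁻¹) := by
    refine (continuousAt_matrix_inv (S.isUnit_det_gMatrix hφ ho)).tendsto.comp ?_
    exact tendsto_pi_nhds.2 fun i => tendsto_pi_nhds.2 fun j => hg i j
  have hUlim : Tendsto (fun x => toCoord φ x (u x)) (𝓝[N] o) (𝓝 (WithLp.toLp 2 fun i =>
      ∑ j, (S.gMatrix φ o)⁻¹ i j * ((∑ k, ξ o k * A j k) / -√L))) := by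
    have h1 : Tendsto (fun x => fun i => ∑ j, (S.gMatrix φ x)⁻¹ i j * ul x j) (𝓝[N] o)
        (𝓝 fun i => ∑ j, (S.gMatrix φ o)⁻¹ i j * ((∑ k, ξ o k * A j k) / -√L)) :=
      tendsto_pi_nhds.2 fun i => tendsto_finsetSum _ fun j _ =>
        ((tendsto_pi_nhds.1 (tendsto_pi_nhds.1 hinv i)) j).mul (hullim j)
    refine (((PiLp.continuous_toLp 2 _).tendsto _).comp h1).congr' ?_
    filter_upwards [hsrc] with x hx
    ext i
    have h2 : ul x = (S.gMatrix φ x).mulVec (fun j => toCoord φ x (u x) j) := by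
      ext i
      simp only [hul]
      rw [S.symm, S.apply_partialVec hφ hx]
    have h3 : (S.gMatrix φ x)⁻¹.mulVec (ul x) = fun j => toCoord φ x (u x) j := by
      rw [h2, Matrix.mulVec_mulVec, Matrix.nonsing_inv_mul _ (S.isUnit_det_gMatrix hφ hx),
        Matrix.one_mulVec]
    exact congrFun h3 i
  refine ⟨_, hUlim, ?_, ?_⟩
  · refine tendsto_nhds_unique (tendsto_coordForm hg hUlim hUlim) (tendsto_const_nhds.congr' ?_)
    filter_upwards [hsrc, hNev] with x hx hxN
    rw [← apply_eq_coordForm S.g hφ hx, hunit x hxN]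
  · refine (tendsto_nhds_unique (tendsto_coordForm hg hξlim hUlim)
      (hαlim.congr' ?_)).trans_lt (neg_lt_zero.2 (Real.sqrt_pos.2 hLpos))
    filter_upwards [hsrc] with x hx
    rw [hξ, ← apply_eq_coordForm S.g hφ hx, hα, S.symm]

end ContinuousSpacetime

end Cosmo

/-! ### A limit of `u` at `o` produces a timelike loop through `o`. -/

namespace Cosmo

namespace ContinuousSpacetime

variable {n : ℕ} {M : Type*} [TopologicalSpace M] [ChartedSpace (Coord n) M]
  [IsManifold 𝓘(ℝ, Coord n) ∞ M] {S : ContinuousSpacetime n M}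
  {φ : OpenPartialHomeomorph M (Coord n)} {N : Set M} {u : VField n M} {o : M}

/-- Coordinate directions close to a future directed timelike direction at `o` are uniformly future
directed timelike near `o`. -/
lemma exists_uniformly_timelike (S : ContinuousSpacetime n M) (hφ : φ ∈ smoothCharts n M)
    (ho : o ∈ φ.source) {w : Coord n} (hw : coordForm S.g φ o w w = -1)
    (hXw : coordForm S.g φ o (toCoord φ o (S.X o)) w < 0) :
    ∃ η > 0, ∀ᶠ x in 𝓝 o, ∀ v : Coord n, ‖v - w‖ < η → coordForm S.g φ x v v < -(1 / 2) ∧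
      coordForm S.g φ x (toCoord φ x (S.X x)) v < 0 := by
  have hfst : Tendsto (Prod.fst : M × Coord n → M) (𝓝 o ×ˢ 𝓝 w) (𝓝 o) := tendsto_fst
  have hsnd : Tendsto (Prod.snd : M × Coord n → Coord n) (𝓝 o ×ˢ 𝓝 w) (𝓝 w) := tendsto_snd
  have hg (i j : Fin (n + 1)) : Tendsto (fun z : M × Coord n => comp2 S.g φ i j z.1)
      (𝓝 o ×ˢ 𝓝 w) (𝓝 (comp2 S.g φ i j o)) :=
    (S.continuousAt_comp2 hφ ho i j).tendsto.comp hfst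
  have hξ := (continuousAt_toCoord_field hφ S.continuous_X ho).tendsto.comp hfst
  have h1 := (tendsto_coordForm hg hsnd hsnd).eventually_lt_const
    (show coordForm S.g φ o w w < -(1 / 2) by rw [hw]; norm_num)
  have h2 := (tendsto_coordForm hg hξ hsnd).eventually_lt_const hXw
  -- The product filter supplies a neighborhood of `o` and a radius `η` that are independent of each
  -- other.
  obtain ⟨pa, hpa, pb, hpb, h⟩ := eventually_prod_iff.1 (h1.and h2)
  obtain ⟨η, hη, hball⟩ := Metric.eventually_nhds_iff.1 hpb
  refine ⟨η, hη, hpa.mono fun x hx v hv => ?_⟩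
  exact h hx (hball (by rwa [dist_eq_norm]))

/-- If all integral curves of `u` emanate from `o` and fill its timelike future `N`, then `u` has no
future directed unit timelike limit at `o` unless `o` itself lies in `N`. -/
lemma IntegralCurvesEmanateFrom.mem_of_tendsto [T2Space M] (hn : 1 ≤ n)
    (h : S.IntegralCurvesEmanateFrom N u o) (hNo : IsOpen N)
    (hN : N = S.timelikeFuture o univ)
    (hu : ContMDiffOn 𝓘(ℝ, Coord n) 𝓘(ℝ, Coord n).tangent ∞
      (fun x => (⟨x, u x⟩ : TangentBundle 𝓘(ℝ, Coord n) M)) N)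
    (hφ : φ ∈ smoothCharts n M) (ho : o ∈ φ.source) {w : Coord n}
    (hlim : Tendsto (fun x => toCoord φ x (u x)) (𝓝[N] o) (𝓝 w))
    (hw : coordForm S.g φ o w w = -1)
    (hXw : coordForm S.g φ o (toCoord φ o (S.X o)) w < 0) : o ∈ N := by
  have hw0 : w ≠ 0 := by
    rintro rfl
    simp [coordForm] at hw
  have hwpos : 0 < ‖w‖ := norm_pos_iff.2 hw0
  obtain ⟨e, he, hew⟩ := exists_norm_eq_one_inner_eq_zero hn hw0
  obtain ⟨η₀, hη₀, htl⟩ := S.exists_uniformly_timelike hφ ho hw hXw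
  -- The tilt `θ` keeps `w + θe` within `η₀` of `w`. The bound `η ≤ θ/4` contradicts `θ/2 ≤ η` later
  -- and keeps `2η` below `η₀`; `η ≤ ‖w‖/2` is what the chord estimate needs.
  set θ := η₀ / 2 with hθ
  set η := min (θ / 4) (‖w‖ / 2) with hη
  have hθpos : 0 < θ := by positivity
  have hηpos : 0 < η := lt_min (by positivity) (by positivity)
  have hηθ : η ≤ θ / 4 := min_le_left _ _
  have hnear : ∀ᶠ x in 𝓝 o, x ∈ N → ‖toCoord φ x (u x) - w‖ ≤ η := by
    have := hlim.eventually (Metric.closedBall_mem_nhds w hηpos)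
    rw [eventually_nhdsWithin_iff] at this
    exact this.mono fun x hx hxN => by simpa [dist_eq_norm] using hx hxN
  set y₀ := φ o with hy₀
  have hsymm : φ.symm y₀ = o := φ.left_inv ho
  have hy₀t : y₀ ∈ φ.target := φ.map_source ho
  obtain ⟨δ, hδ, hball⟩ : ∃ δ > 0, ∀ y ∈ Metric.ball y₀ δ, y ∈ φ.target ∧
      (∀ v : Coord n, ‖v - w‖ < η₀ → coordForm S.g φ (φ.symm y) v v < -(1 / 2) ∧
        coordForm S.g φ (φ.symm y) (toCoord φ (φ.symm y) (S.X (φ.symm y))) v < 0) ∧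
      (φ.symm y ∈ N → ‖toCoord φ (φ.symm y) (u (φ.symm y)) - w‖ ≤ η) := by
    have hc : Tendsto φ.symm (𝓝 y₀) (𝓝 o) := by
      have := (φ.symm.continuousAt (x := y₀) hy₀t).tendsto
      rwa [hsymm] at this
    exact Metric.eventually_nhds_iff_ball.1
      ((eventually_mem_set.2 (φ.open_target.mem_nhds hy₀t)).and
        ((hc.eventually htl).and (hc.eventually hnear)))
  have hseg {v y : Coord n} {a b : ℝ} (hab : a < b) (hv : ‖v - w‖ < η₀)
      (hin : ∀ t ∈ Icc a b, y + t • v ∈ Metric.ball y₀ δ) :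
      S.IsTimelikeCurve (fun t => φ.symm (y + t • v)) a b :=
    isTimelikeCurve_segment hφ hab (ε := 1 / 2) (by norm_num)
      (fun t ht => (hball _ (hin t ht)).1)
      (fun t ht => ((hball _ (hin t ht)).2.1 v hv).1)
      (fun t ht => ((hball _ (hin t ht)).2.1 v hv).2)
  -- Backward time during which a curve of speed at most `‖w‖ + η` moves by at most `δ/4`.
  set s₀ := δ / (4 * (‖w‖ + η)) with hs₀
  have hs₀pos : 0 < s₀ := by positivity
  have hs₀w : (‖w‖ + η) * s₀ = δ / 4 := by
    rw [hs₀]; field_simp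
  set v := w + θ • e with hv
  have hvw : ‖v - w‖ < η₀ := by
    rw [hv, add_sub_cancel_left, norm_smul, he, Real.norm_of_nonneg hθpos.le]
    linarith
  -- The tilted segment stays in the ball, and its length is at most `η s₀`, comparable to the drift
  -- error after time `s₀`.
  set τ := min (δ / 4) (η * s₀) / (‖v‖ + 1) with hτ
  have hmin : 0 < min (δ / 4) (η * s₀) := lt_min (by positivity) (by positivity)
  have hτpos : 0 < τ := by positivity
  have hτv : τ * ‖v‖ ≤ min (δ / 4) (η * s₀) := by
    have h1 : τ * (‖v‖ + 1) = min (δ / 4) (η * s₀) := by rw [hτ]; field_simp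
    nlinarith
  have hτδ : τ * ‖v‖ ≤ δ / 4 := hτv.trans (min_le_left _ _)
  have hτη : τ * ‖v‖ ≤ η * s₀ := hτv.trans (min_le_right _ _)
  have hline (t : ℝ) (ht : t ∈ Icc 0 τ) : y₀ + t • v ∈ Metric.ball y₀ δ := by
    rw [mem_ball_iff_norm, add_sub_cancel_left, norm_smul, Real.norm_of_nonneg ht.1]
    have := mul_le_mul_of_nonneg_right ht.2 (norm_nonneg v)
    linarith
  have hqt : y₀ + τ • v ∈ φ.target := (hball _ (hline τ (right_mem_Icc.2 hτpos.le))).1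
  set q := φ.symm (y₀ + τ • v) with hq
  have hφq : φ q = y₀ + τ • v := φ.right_inv hqt
  have hqN : q ∈ N := by
    rw [hN]
    exact ⟨_, 0, τ, hseg hτpos hvw hline, mapsTo_univ _ _, by simp [hsymm], rfl⟩
  obtain ⟨Γ, a, t₀, d, ht₀, hΓq, hΓN, hΓu, hΓa, -, hΓt⟩ := h.exists_curve hNo hu hqN
  have hα : max a (t₀ - s₀) ≤ t₀ := max_le ht₀.1.le (by linarith)
  have hdrift := norm_chart_add_smul_le_of_deriv_near (φ := φ) (γ := Γ) (α := max a (t₀ - s₀))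
    (β := t₀) (δ := δ) (η := η) (y₀ := y₀) (w := w) hα
    ((hΓt t₀ ht₀).2.1.1.mono (Icc_subset_Icc_left (le_max_left _ _)))
    (fun y hy => (hball y hy).1) hηpos.le
    (fun t ht hs hb => by
      have htI : t ∈ Ioo a d := ⟨(le_max_left _ _).trans_lt ht.1, ht.2.trans_lt ht₀.2⟩
      refine ⟨_, hasDerivAt_chart_comp hφ (hΓu t htI) hs, ?_⟩
      have h1 := (hball _ hb).2.2
      rw [φ.left_inv hs] at h1
      exact h1 (hΓN htI))
    (by rw [hΓq]; exact φ.map_target hqt)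
    (by
      rw [hΓq, hφq, add_sub_cancel_left, norm_smul, Real.norm_of_nonneg hτpos.le]
      have h1 : t₀ - max a (t₀ - s₀) ≤ s₀ := by linarith [le_max_right a (t₀ - s₀)]
      have h2 := mul_le_mul_of_nonneg_left h1 (show 0 ≤ ‖w‖ + η by positivity)
      linarith)
  rw [hΓq, hφq] at hdrift
  -- Either the integral curve reaches `o` within backward time `s₀`, and its chord from `o` to `q`
  -- contradicts the tilt, or it is still in `M` at time `t₀ - s₀`.
  rcases le_or_gt (t₀ - s₀) a with hcase | hcase
  · exfalso
    rw [max_eq_left hcase] at hdrift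
    have h1 := (hdrift a ⟨le_rfl, ht₀.1.le⟩).2
    rw [hΓa] at h1
    have h2 : φ o - (y₀ + τ • v) + (t₀ - a) • w = (t₀ - a) • w - τ • (w + θ • e) := by
      rw [← hy₀, ← hv]; abel
    rw [h2] at h1
    have := half_le_of_norm_smul_sub_smul_le hw0 he hew (sub_pos.2 ht₀.1) hθpos
      (min_le_right _ _) h1
    linarith
  · rw [max_eq_right hcase.le] at hdrift
    set t₁ := t₀ - s₀ with ht₁
    have ht₁₀ : t₁ < t₀ := by linarith
    obtain ⟨hrs, hr⟩ := hdrift t₁ ⟨le_rfl, ht₁₀.le⟩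
    have hst : t₀ - t₁ = s₀ := by rw [ht₁]; ring
    rw [hst] at hr
    -- Velocity of the segment that returns from `Γ t₁` to `o` in time `s₀`. Drift and displacement
    -- of `q` each contribute at most `η` to its distance from `w`, so the segment is timelike.
    set w' := s₀⁻¹ • (y₀ - φ (Γ t₁)) with hw'
    have hsw' : s₀ • w' = y₀ - φ (Γ t₁) := by
      rw [hw', smul_smul, mul_inv_cancel₀ hs₀pos.ne', one_smul]
    have hw'w : ‖w' - w‖ ≤ 2 * η := by
      have h1 : s₀ • (w' - w) = -(φ (Γ t₁) - (y₀ + τ • v) + s₀ • w) - τ • v := by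
        rw [smul_sub, hsw']; abel
      have h2 : s₀ * ‖w' - w‖ ≤ η * s₀ + η * s₀ := by
        have h3 : ‖s₀ • (w' - w)‖ = s₀ * ‖w' - w‖ := by
          rw [norm_smul, Real.norm_of_nonneg hs₀pos.le]
        rw [← h3, h1]
        refine (norm_sub_le _ _).trans (add_le_add (by rwa [norm_neg]) ?_)
        rwa [norm_smul, Real.norm_of_nonneg hτpos.le]
      refine le_of_mul_le_mul_left ?_ hs₀pos
      linarith
    have hw'n : ‖w'‖ ≤ ‖w‖ + 2 * η := by
      have := norm_add_le (w' - w) w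
      rw [sub_add_cancel] at this
      linarith
    have hline' (t : ℝ) (ht : t ∈ Icc t₁ t₀) : (y₀ - t₀ • w') + t • w' ∈ Metric.ball y₀ δ := by
      have h1 : (y₀ - t₀ • w') + t • w' - y₀ = (t - t₀) • w' := by module
      rw [mem_ball_iff_norm, h1, norm_smul, Real.norm_of_nonpos (by linarith [ht.2])]
      have h2 : -(t - t₀) * ‖w'‖ ≤ s₀ * (‖w‖ + 2 * η) :=
        mul_le_mul (by linarith [ht.1]) hw'n (norm_nonneg _) hs₀pos.le
      nlinarith
    have hcurve := hseg (v := w') ht₁₀ (by linarith) hline'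
    have hjoin : Γ t₁ = φ.symm ((y₀ - t₀ • w') + t₁ • w') := by
      have h1 : (y₀ - t₀ • w') + t₁ • w' = φ (Γ t₁) := by
        have h2 : (y₀ - t₀ • w') + t₁ • w' = y₀ - s₀ • w' := by rw [← hst]; module
        rw [h2, hsw']; abel
      rw [h1, φ.left_inv hrs]
    rw [hN]
    refine ⟨_, a, t₀, (hΓt t₁ ⟨hcase, ht₁₀.trans ht₀.2⟩).concat hcurve hjoin, mapsTo_univ _ _,
      ?_, ?_⟩
    · simp only [hcase.le, if_true, hΓa]
    · simp only [not_le.2 ht₁₀, if_false, sub_add_cancel, hsymm]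

end ContinuousSpacetime

end Cosmo

/-! ### Boundedness of `u_*` along an integral curve, and the conclusion. -/

namespace Cosmo.ContinuousSpacetime

variable {n : ℕ} {M : Type*} [TopologicalSpace M] [ChartedSpace (Coord n) M]
  [IsManifold 𝓘(ℝ, Coord n) ∞ M] {S : ContinuousSpacetime n M}
  {φ : OpenPartialHomeomorph M (Coord n)} {u : VField n M} {o : M}

/-- The covariant components are `gᵢⱼ uʲ`, sums of products of convergent metric components with
bounded coordinates of `u`. -/
lemma isBigO_apply_partialVec {α : Type*} {l : Filter α} {x : α → M} {C : ℝ}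
    (hφ : φ ∈ smoothCharts n M) (ho : o ∈ φ.source) (hx : Tendsto x l (𝓝 o))
    (hC : ∀ᶠ a in l, ‖toCoord φ (x a) (u (x a))‖ ≤ C) (i : Fin (n + 1)) :
    (fun a => S.g (x a) (u (x a)) (partialVec φ (x a) i)) =O[l] fun _ => (1 : ℝ) := by
  have h1 : (fun a => ∑ j, comp2 S.g φ i j (x a) * toCoord φ (x a) (u (x a)) j)
      =O[l] fun _ => (1 : ℝ) := by
    refine Asymptotics.IsBigO.fun_sum (fun j _ => ?_)
    have h2 := (((S.continuousAt_comp2 hφ ho i j).tendsto.comp hx).isBigO_one ℝ)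
    have h3 : (fun a => toCoord φ (x a) (u (x a)) j) =O[l] fun _ => (1 : ℝ) := by
      refine Asymptotics.IsBigO.of_bound C (hC.mono fun a ha => ?_)
      rw [norm_one, mul_one]
      exact (PiLp.norm_apply_le _ j).trans ha
    simpa using h2.mul h3
  refine h1.congr' ?_ EventuallyEq.rfl
  filter_upwards [hx.eventually_mem (φ.open_source.mem_nhds ho)] with a ha
  rw [S.symm, S.apply_partialVec hφ ha]
  rfl

end Cosmo.ContinuousSpacetime

theorem corollary2p5 {n : ℕ} (hn : 2 ≤ n) {Mext : Type*} [TopologicalSpace Mext] [T2Space Mext]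
    [SecondCountableTopology Mext] [ChartedSpace (Cosmo.Coord n) Mext]
    [IsManifold 𝓘(ℝ, Cosmo.Coord n) ∞ Mext]
    (S : Cosmo.ContinuousSpacetime n Mext) (M : Set Mext) (o : Mext)
    (hext : S.IsContinuousExtensionOf M)
    (ho : o ∈ S.pastBoundary M)
    (hM : M = S.timelikeFuture o Set.univ)
    (u : Cosmo.VField n Mext) (ρ p : Mext → ℝ)
    (ha : S.SolvesEinsteinPerfectFluid M u ρ p)
    (hb : S.IntegralCurvesEmanateFrom M u o)
    (ρ' p' : Mext → ℝ) (Ric' : Cosmo.Tensor2 n Mext)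
    (hc_Ric : Cosmo.IsContExtTensor M o (Cosmo.ricci S.g) Ric')
    (hc_ρ : Cosmo.IsContExtFun M o ρ ρ')
    (hc_p : Cosmo.IsContExtFun M o p p')
    (hd : S.StronglyCausalAt o ∨ S.PastBoundaryLocallyInFuture M o) :
    ∀ v w : Cosmo.Tan n o,
      Ric' o v w = 16 * Real.pi * ρ' o / ((n : ℝ) - 1) * S.g o v w := by
  obtain ⟨hRic, φ, hφ, hoφ, hRicc⟩ := hc_Ric
  have hclos : o ∈ closure M := ho.1.1
  have hoM : o ∉ M := ho.1.2
  have hMev : ∀ᶠ x in 𝓝[M] o, x ∈ M := self_mem_nhdsWithin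
  have hext_lim {f f' : Mext → ℝ} (h : Cosmo.IsContExtFun M o f f') :
      Tendsto f (𝓝[M] o) (𝓝 (f' o)) := by
    refine ((h.2 o (mem_insert o M)).mono_left
      (nhdsWithin_mono o (subset_insert o M))).congr' ?_
    filter_upwards [hMev] with x hx using h.1 hx
  have hρ := hext_lim hc_ρ
  have hp := hext_lim hc_p
  have hRlim (i j : Fin (n + 1)) : Tendsto (Cosmo.comp2 Ric' φ i j) (𝓝[M] o)
      (𝓝 (Cosmo.comp2 Ric' φ i j o)) := by
    refine (hRicc i j o ⟨hoφ, mem_insert o M⟩).mono_left ?_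
    rw [nhdsWithin_inter_of_mem (nhdsWithin_le_nhds (φ.open_source.mem_nhds hoφ))]
    exact nhdsWithin_mono o (subset_insert o M)
  have hg (i j : Fin (n + 1)) : Tendsto (Cosmo.comp2 S.g φ i j) (𝓝[M] o)
      (𝓝 (Cosmo.comp2 S.g φ i j o)) :=
    (S.continuousAt_comp2 hφ hoφ i j).mono_left nhdsWithin_le_nhds
  set q : Fin (n + 1) → Mext → ℝ := fun i x => S.g x (u x) (Cosmo.partialVec φ x i) with hq
  have heq (i j : Fin (n + 1)) : ∀ᶠ x in 𝓝[M] o,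
      Cosmo.comp2 Ric' φ i j x - 8 * Real.pi * (ρ x - p x) / ((n : ℝ) - 1) *
        Cosmo.comp2 S.g φ i j x = 8 * Real.pi * ((ρ x + p x) * (q i x * q j x)) := by
    filter_upwards [hMev] with x hx
    simp only [Cosmo.comp2, hRic x hx, hq]
    rw [ha.ricci_eq hn hx]
    ring
  have hlhs (i j : Fin (n + 1)) : Tendsto (fun x => Cosmo.comp2 Ric' φ i j x
      - 8 * Real.pi * (ρ x - p x) / ((n : ℝ) - 1) * Cosmo.comp2 S.g φ i j x) (𝓝[M] o)
      (𝓝 (Cosmo.comp2 Ric' φ i j o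
        - 8 * Real.pi * (ρ' o - p' o) / ((n : ℝ) - 1) * Cosmo.comp2 S.g φ i j o)) :=
    (hRlim i j).sub ((((hρ.sub hp).const_mul _).div_const _).mul (hg i j))
  -- Otherwise division by `ρ + p` makes `u_*⊗u_*` converge at `o`.
  have hsum : ρ' o + p' o = 0 := by
    by_contra hne
    have hA (i j : Fin (n + 1)) := ((hlhs i j).div ((hρ.add hp).const_mul (8 * Real.pi))
      (mul_ne_zero (by positivity) hne)).congr' (f₂ := fun x => q i x * q j x) (by
        filter_upwards [heq i j, (hρ.add hp).eventually_ne hne] with x hx hx0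
        have hx0' : ρ x + p x ≠ 0 := hx0
        have hpi := Real.pi_ne_zero
        simp only [Pi.div_apply]
        rw [hx]
        field_simp)
    obtain ⟨w, hwlim, hw, hXw⟩ := Cosmo.ContinuousSpacetime.exists_tendsto_toCoord hφ hoφ hclos
      ha.future_u ha.unit_u hA
    exact hoM (hb.mem_of_tendsto (by omega) hext.isOpen hM ha.smooth_u hφ hoφ hwlim hw hXw)
  have hcomp (i j : Fin (n + 1)) : Cosmo.comp2 Ric' φ i j o
      = 16 * Real.pi * ρ' o / ((n : ℝ) - 1) * Cosmo.comp2 S.g φ i j o := by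
    obtain ⟨x₀, hx₀⟩ : M.Nonempty := closure_nonempty_iff.1 ⟨o, hclos⟩
    obtain ⟨Γ, a, t₀, d, ht₀, -, hΓM, hΓu, hΓa, hΓlim, hΓt⟩ :=
      hb.exists_curve hext.isOpen ha.smooth_u hx₀
    obtain ⟨C, hC⟩ := Cosmo.exists_bound_toCoord_of_lipschitz (u := u) hφ hoφ ht₀.1
      (hΓt t₀ ht₀).2.1 hΓa fun t ht => hΓu t ⟨ht.1, ht.2.trans ht₀.2⟩
    have hΓlim' : Tendsto Γ (𝓝[>] a) (𝓝[M] o) := by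
      refine tendsto_nhdsWithin_iff.2 ⟨hΓlim, ?_⟩
      filter_upwards [Ioo_mem_nhdsGT (ht₀.1.trans ht₀.2)] with t ht using hΓM ht
    have hO (k : Fin (n + 1)) :=
      Cosmo.ContinuousSpacetime.isBigO_apply_partialVec (S := S) hφ hoφ hΓlim hC k
    have h0 : Tendsto (fun t => (ρ (Γ t) + p (Γ t)) * (q i (Γ t) * q j (Γ t))) (𝓝[>] a)
        (𝓝 0) := by
      have h1 : (fun t => ρ (Γ t) + p (Γ t)) =o[𝓝[>] a] fun _ => (1 : ℝ) := by
        rw [Asymptotics.isLittleO_one_iff, ← hsum]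
        exact (hρ.add hp).comp hΓlim'
      have h2 := h1.mul_isBigO ((hO i).mul (hO j))
      simp only [mul_one] at h2
      exact (Asymptotics.isLittleO_one_iff ℝ).1 h2
    -- The left side of `heq` converges along all of `M`, so its limit can be computed along this
    -- single curve, where the right side is `o(1)` times a bounded factor.
    have h3 := tendsto_nhds_unique ((hlhs i j).comp hΓlim')
      ((h0.const_mul (8 * Real.pi)).congr' (by
        filter_upwards [hΓlim'.eventually (heq i j)] with t ht using ht.symm))
    have hp' : p' o = -ρ' o := by linarith
    rw [hp', mul_zero, sub_eq_zero] at h3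
    rw [h3]
    ring
  intro v w
  rw [Cosmo.apply_eq_coordForm Ric' hφ hoφ, Cosmo.apply_eq_coordForm S.g hφ hoφ]
  simp only [Cosmo.coordForm, hcomp, Finset.mul_sum]
  refine Finset.sum_congr rfl fun i _ => Finset.sum_congr rfl fun j _ => ?_
  ring
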